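/- All graphs are non-empty, simple, unoriented and connected, with graph distance $d$. A graph has bounded degree if there is a finite uniform bound on the number of neighbours of its vertices. For such a graph $\mathcal{G}$ and $p\in[0,1]$, Bernoulli bond percolation of parameter $p$ on $\mathcal{G}$ keeps each edge independently with probability $p$ and erases it otherwise; the connected components of the resulting random graph are called clusters. The critical parameter is $$p_c(\mathcal{G}):=\sup\{p\in[0,1] : \text{almost surely, there is no infinite cluster}\}.$$ Let $\mathcal{G}$ and $\mathcal{H}$ be connected graphs of bounded degree. Let $\pi:V(\mathcal{G})\to V(\mathcal{H})$ be a strong covering map with tame fibres, i.e. a map such that - $\pi$ is $1$-Lipschitz: $d(\pi(x),\pi(y))\le d(x,y)$ for all $x,y\in V(\mathcal{G})$; - $\pi$ has the strong lifting property: for every $x\in V(\mathcal{G})$ and every neighbour $u$ of $\pi(x)$ in $\mathcal{H}$, there is a unique neighbour of $x$ in $\mathcal{G}$ that is mapped to $u$ by $\pi$; - $\pi$ has tame fibres: there is some $R$ such that for every $x\in V(\mathcal{G})$, there is some $y\in V(\mathcal{G})$ with $\pi(x)=\pi(y)$ and $0<d(x,y)\le R$. If $p_c(\mathcal{G})<1$,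 then $p_c(\mathcal{G})<p_c(\mathcal{H})$. -/

import Mathlib

noncomputable section

namespace BondPercolation

open MeasureTheory ProbabilityTheory unitInterval

/-- A graph has bounded degree if the numbers of neighbours of its vertices are uniformly bounded.
In particular, such a graph is locally finite. -/
def BoundedDegree {V : Type*} (G : SimpleGraph V) : Prop :=
  ∃ D : ℕ, ∀ x : V, (G.neighborSet x).encard ≤ D

/-- Edge configurations `{0,1}^E`: an edge `e` is open in `ω` if `ω e = true`, and it is closed
(erased) if `ω e = false`. -/
abbrev Config {V : Type*} (G : SimpleGraph V) : Type _ := G.edgeSet → Bool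

/-- The law `Ber(p)^{⊗E}` of Bernoulli bond percolation of parameter `p` on `G`: each edge is open
with probability `p` and closed with probability `1 - p`, independently of the other edges. -/
def percolation {V : Type*} (G : SimpleGraph V) (p : I) : Measure (Config G) :=
  Measure.infinitePi fun _ : G.edgeSet => bernoulliMeasure true false p

/-- The spanning subgraph of `G` that consists of the open edges of `ω`. -/
def openGraph {V : Type*} (G : SimpleGraph V) (ω : Config G) : SimpleGraph V where
  Adj x y := ∃ h : G.Adj x y, ω ⟨s(x, y), h⟩ = true
  symm := ⟨fun x y ⟨h, hω⟩ => ⟨h.symm, by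
    have e : (⟨s(y, x), h.symm⟩ : G.edgeSet) = ⟨s(x, y), h⟩ := Subtype.ext Sym2.eq_swap
    rw [e]; exact hω⟩⟩
  loopless := ⟨fun x ⟨h, _⟩ => G.loopless.irrefl x h⟩

/-- The cluster of the vertex `x`: its connected component in the open subgraph. -/
def cluster {V : Type*} (G : SimpleGraph V) (ω : Config G) (x : V) : Set V :=
  {y | (openGraph G ω).Reachable x y}

/-- There is at least one infinite cluster. -/
def HasInfiniteCluster {V : Type*} (G : SimpleGraph V) (ω : Config G) : Prop :=
  ∃ x : V, (cluster G ω x).Infinite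

/-- The critical parameter `p_c(G)`: the supremum of the `p ∈ [0,1]` such that almost surely, there
is no infinite cluster. The set is bounded above by `1` and contains `0`; for a finite graph, the
value is `1`. -/
def criticalParameter {V : Type*} (G : SimpleGraph V) : ℝ :=
  sSup {p : ℝ | ∃ hp : p ∈ I, ∀ᵐ ω ∂(percolation G ⟨p, hp⟩), ¬ HasInfiniteCluster G ω}

/-- A strong covering map between (connected) graphs: it is 1-Lipschitz for the graph distances and
has the strong lifting property. It need not be a graph homomorphism. -/
structure IsStrongCoveringMap {V W : Type*} (G : SimpleGraph V) (H : SimpleGraph W)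
    (π : V → W) : Prop where
  dist_le : ∀ x y : V, H.dist (π x) (π y) ≤ G.dist x y
  existsUnique_lift : ∀ (x : V) (u : W), H.Adj (π x) u → ∃! z : V, G.Adj x z ∧ π z = u

/-- The map `π`, defined on the vertices of the (connected) graph `G`, has tame fibres: for some
`R`, every vertex `x` lies within distance `R` of another vertex of its fibre. -/
def HasTameFibres {V W : Type*} (G : SimpleGraph V) (π : V → W) : Prop :=
  ∃ R : ℕ, ∀ x : V, ∃ y : V, π x = π y ∧ 0 < G.dist x y ∧ G.dist x y ≤ R

end BondPercolation

end

/-! Exploring the cluster of `π x₀` in `H` while answering each query of an edge by one of its lifts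
in `G` shows that the cluster of `x₀` dominates that of `π x₀`, at equal parameter. Strictness comes
from an intermediate model on `H`: vertices are activated independently, and a fully open ball of
radius `r` around an activated vertex may be left through any edge.

Two comparisons carry the proof, both for the events of reaching distance `n`, written as finite
sums `productExp`, with constants uniform in `n`.

Enhancement gain (`exists_enhancement_gain`): on `H`, lowering the edge parameter from `p + δ` to
`p` is compensated by a small activation density. A pivotal edge can be turned, by changes in a
bounded window, into a pivotal activation (`exists_pivotal_activation`), so parameter can be
transferred from edges to activations, one edge at a time (`productExp_exchange`).

Lifting (`LiftStage.productExp_le`): percolation on `G` at `p` dominates the enhanced model on `H`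
at `p` with small activation density. By tame fibres, every vertex of an open explored ball has two
reachable lifts, whereas each explored vertex has a single distinguished lift, from which its edges
are queried. So an edge that was found closed leaves another lift through which to exit. The
randomness for that exit is created by sprinkling: edges of `G` that were not queried give up a
little of their parameter for an additional trial. Bounded degree limits how often an edge is
solicited.

Now take `p` slightly below the critical parameter of `H`, with `p + δ` above it. Then `H`
percolates at `p + δ`, so the enhanced model at `p` reaches every distance with probability bounded
below, and hence so does `G` at `p`. The margins need the critical parameter of `H` to lie in the
open unit interval: positivity is `criticalParameter_pos`, and the value 1 is covered by the
assumption on `G`. -/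

namespace BondPercolation

/-! ### Finite product expectations: monotonicity, sprinkling, exchange of parameters -/

/-- The expectation of `f (η ∪ B)`, where `B` is a random subset of the finite set `S` that contains
each `i ∈ S` independently with probability `q i`. -/
def productExp {ι : Type*} [DecidableEq ι] (q : ι → ℝ) (S : Finset ι) (f : Set ι → ℝ)
    (η : Set ι) : ℝ :=
  ∑ B ∈ S.powerset, (∏ i ∈ B, q i) * (∏ i ∈ S \ B, (1 - q i)) * f (η ∪ ↑B)

theorem monotone_indicator_one {ι : Type*} {A : Set (Set ι)} (hA : IsUpperSet A) :
    Monotone (A.indicator (1 : Set ι → ℝ)) := by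
  intro ω ω' h
  by_cases hω : ω ∈ A
  · rw [Set.indicator_of_mem hω, Set.indicator_of_mem (hA h hω)]
    exact le_rfl
  · rw [Set.indicator_of_notMem hω]
    exact Set.indicator_nonneg (fun _ _ => zero_le_one) _

theorem indicator_one_nonneg {ι : Type*} (A : Set (Set ι)) (ω : Set ι) :
    0 ≤ A.indicator (1 : Set ι → ℝ) ω :=
  Set.indicator_nonneg (fun _ _ => zero_le_one) _

theorem indicator_one_le_one {ι : Type*} (A : Set (Set ι)) (ω : Set ι) :
    A.indicator (1 : Set ι → ℝ) ω ≤ 1 :=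
  Set.indicator_le_self' (fun _ _ => zero_le_one) _

section ProductExp

variable {ι : Type*} [DecidableEq ι] {q q' : ι → ℝ} {S S' : Finset ι} {f g : Set ι → ℝ}
  {η η' : Set ι} {i : ι}

@[simp] theorem productExp_empty : productExp q ∅ f η = f η := by
  simp [productExp]

theorem productExp_insert (hi : i ∉ S) :
    productExp q (insert i S) f η
      = q i * productExp q S f (insert i η) + (1 - q i) * productExp q S f η := by
  unfold productExp
  rw [Finset.sum_powerset_insert hi, add_comm, Finset.mul_sum, Finset.mul_sum]
  congr 1
  · refine Finset.sum_congr rfl fun B hB => ?_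
    have hBS := Finset.mem_powerset.1 hB
    have hiB : i ∉ B := fun h => hi (hBS h)
    have h1 : insert i S \ insert i B = S \ B := by
      ext j; simp only [Finset.mem_sdiff, Finset.mem_insert]; grind
    have h2 : η ∪ ↑(insert i B) = insert i η ∪ (↑B : Set ι) := by
      ext j; simp; tauto
    rw [Finset.prod_insert hiB, h1, h2]; ring
  · refine Finset.sum_congr rfl fun B hB => ?_
    have hBS := Finset.mem_powerset.1 hB
    have hiB : i ∉ B := fun h => hi (hBS h)
    have h1 : insert i S \ B = insert i (S \ B) := by
      ext j; simp only [Finset.mem_sdiff, Finset.mem_insert]; grind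
    rw [h1, Finset.prod_insert (by simp [hi])]; ring

theorem productExp_eq_erase (hi : i ∈ S) :
    productExp q S f η = q i * productExp q (S.erase i) f (insert i η)
      + (1 - q i) * productExp q (S.erase i) f η := by
  conv_lhs => rw [← Finset.insert_erase hi]
  exact productExp_insert (Finset.notMem_erase i S)

theorem productExp_congr_left (h : ∀ i ∈ S, q i = q' i) :
    productExp q S f η = productExp q' S f η := by
  refine Finset.sum_congr rfl fun B hB => ?_
  have hBS := Finset.mem_powerset.1 hB
  have h1 : ∏ j ∈ B, q j = ∏ j ∈ B, q' j := Finset.prod_congr rfl fun j hj => h j (hBS hj)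
  have h2 : ∏ j ∈ S \ B, (1 - q j) = ∏ j ∈ S \ B, (1 - q' j) :=
    Finset.prod_congr rfl fun j hj => by rw [h j (Finset.mem_sdiff.1 hj).1]
  rw [h1, h2]

theorem productExp_congr (h : ∀ B ⊆ S, f (η ∪ ↑B) = g (η' ∪ ↑B)) :
    productExp q S f η = productExp q S g η' := by
  refine Finset.sum_congr rfl fun B hB => ?_
  rw [h B (Finset.mem_powerset.1 hB)]

theorem productExp_le (hq : ∀ i ∈ S, 0 ≤ q i ∧ q i ≤ 1)
    (h : ∀ B ⊆ S, f (η ∪ ↑B) ≤ g (η' ∪ ↑B)) :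
    productExp q S f η ≤ productExp q S g η' := by
  refine Finset.sum_le_sum fun B hB => ?_
  have hBS := Finset.mem_powerset.1 hB
  refine mul_le_mul_of_nonneg_left (h B hBS) (mul_nonneg ?_ ?_)
  · exact Finset.prod_nonneg fun j hj => (hq j (hBS hj)).1
  · exact Finset.prod_nonneg fun j hj => by linarith [(hq j (Finset.mem_sdiff.1 hj).1).2]

theorem productExp_const (a : ℝ) : productExp q S (fun _ => a) η = a := by
  induction S using Finset.induction_on generalizing η with
  | empty => simp
  | insert i S hi ih => rw [productExp_insert hi, ih, ih]; ring

theorem productExp_nonneg (hq : ∀ i ∈ S, 0 ≤ q i ∧ q i ≤ 1) (h : ∀ ω, 0 ≤ f ω) :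
    0 ≤ productExp q S f η := by
  rw [← productExp_const (q := q) (S := S) (η := η) 0]
  exact productExp_le hq fun _ _ => h _

theorem productExp_le_one (hq : ∀ i ∈ S, 0 ≤ q i ∧ q i ≤ 1) (h : ∀ ω, f ω ≤ 1) :
    productExp q S f η ≤ 1 := by
  rw [← productExp_const (q := q) (S := S) (η := η) 1]
  exact productExp_le hq fun _ _ => h _

theorem productExp_mono_set (hq : ∀ i ∈ S, 0 ≤ q i ∧ q i ≤ 1) (hf : Monotone f) (h : η ⊆ η') :
    productExp q S f η ≤ productExp q S f η' :=
  productExp_le hq fun _ _ => hf (Set.union_subset_union_left _ h)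

theorem productExp_mono_left (hq : ∀ i ∈ S, 0 ≤ q i ∧ q i ≤ 1) (hq' : ∀ i ∈ S, 0 ≤ q' i ∧ q' i ≤ 1)
    (hf : Monotone f) (h : ∀ i ∈ S, q i ≤ q' i) :
    productExp q S f η ≤ productExp q' S f η := by
  induction S using Finset.induction_on generalizing η with
  | empty => simp
  | insert i S hi ih =>
    rw [productExp_insert hi, productExp_insert hi]
    have hqS : ∀ i ∈ S, 0 ≤ q i ∧ q i ≤ 1 := fun j hj => hq j (Finset.mem_insert_of_mem hj)
    have hqS' : ∀ i ∈ S, 0 ≤ q' i ∧ q' i ≤ 1 := fun j hj => hq' j (Finset.mem_insert_of_mem hj)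
    have ih' := fun η => ih (η := η) hqS hqS' fun j hj => h j (Finset.mem_insert_of_mem hj)
    have h1 := ih' (insert i η)
    have h2 := ih' η
    have h3 : productExp q S f η ≤ productExp q S f (insert i η) :=
      productExp_mono_set hqS hf (Set.subset_insert i η)
    have h4 := h i (Finset.mem_insert_self i S)
    have h5 := hq' i (Finset.mem_insert_self i S)
    nlinarith

theorem productExp_mono_finset (hq : ∀ i, 0 ≤ q i ∧ q i ≤ 1) (hf : Monotone f) (h : S ⊆ S') :
    productExp q S f η ≤ productExp q S' f η := by
  induction S' using Finset.induction_on generalizing S η with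
  | empty => rw [Finset.subset_empty.1 h]
  | insert i S' hi ih =>
    rw [productExp_insert hi]
    by_cases hiS : i ∈ S
    · have hS : S.erase i ⊆ S' := by
        intro j hj
        have := h (Finset.mem_of_mem_erase hj)
        exact (Finset.mem_insert.1 this).resolve_left (Finset.ne_of_mem_erase hj)
      rw [productExp_eq_erase hiS]
      nlinarith [hq i, ih hS (η := η), ih hS (η := insert i η)]
    · have hS : S ⊆ S' := fun j hj =>
        (Finset.mem_insert.1 (h hj)).resolve_left fun e => hiS (e ▸ hj)
      have h3 : productExp q S f η ≤ productExp q S f (insert i η) :=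
        productExp_mono_set (fun j _ => hq j) hf (Set.subset_insert i η)
      nlinarith [hq i, ih hS (η := η), ih hS (η := insert i η)]

theorem productExp_filter (K : Set ι) [DecidablePred (· ∈ K)] :
    productExp q S (fun ω => f (ω ∩ K)) η
      = productExp q (S.filter (· ∈ K)) (fun ω => f (ω ∩ K)) η := by
  induction S using Finset.induction_on generalizing η with
  | empty => simp
  | insert i S hi ih =>
    rw [productExp_insert hi, Finset.filter_insert]
    split_ifs with hK
    · rw [productExp_insert (by simp [hi]), ih, ih]
    · rw [← ih]
      have h : productExp q S (fun ω => f (ω ∩ K)) (insert i η)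
          = productExp q S (fun ω => f (ω ∩ K)) η := by
        refine productExp_congr fun B _ => ?_
        congr 1
        ext j
        simp only [Set.mem_inter_iff, Set.mem_union, Set.mem_insert_iff]
        constructor
        · rintro ⟨(rfl | h) | h, h'⟩
          · exact absurd h' hK
          · exact ⟨Or.inl h, h'⟩
          · exact ⟨Or.inr h, h'⟩
        · rintro ⟨h | h, h'⟩
          · exact ⟨Or.inl (Or.inr h), h'⟩
          · exact ⟨Or.inr h, h'⟩
      rw [h]; ring

theorem productExp_union (h : Disjoint S S') :
    productExp q (S ∪ S') f η = productExp q S (fun ω => productExp q S' f ω) η := by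
  induction S using Finset.induction_on generalizing η with
  | empty => simp
  | insert i S hi ih =>
    rw [Finset.disjoint_insert_left] at h
    rw [Finset.insert_union, productExp_insert (by simp [hi, h.1]), productExp_insert hi,
      ih h.2, ih h.2]

theorem productExp_map {κ : Type*} [DecidableEq κ] (j : κ ↪ ι) (S : Finset κ) (η : Set κ) :
    productExp q (S.map j) f (j '' η)
      = productExp (fun k => q (j k)) S (fun ω => f (j '' ω)) η := by
  induction S using Finset.induction_on generalizing η with
  | empty => simp
  | insert i S hi ih =>
    rw [Finset.map_insert, productExp_insert (by simpa using hi), productExp_insert hi, ih,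
      ← Set.image_insert_eq, ih]

/-- Lowering the parameter of one coordinate by `ε` in exchange for one additional trial. -/
theorem productExp_sprinkle (hq : ∀ i ∈ S, 0 ≤ q i ∧ q i ≤ 1) (hf : Monotone f) (hi : i ∈ S)
    {ε : ℝ} (hε : 0 ≤ ε) (hεq : ε ≤ q i) :
    ε * productExp (Function.update q i (q i - ε)) S f (insert i η)
      + (1 - ε) * productExp (Function.update q i (q i - ε)) S f η ≤ productExp q S f η := by
  have hc : ∀ η, productExp (Function.update q i (q i - ε)) (S.erase i) f η
      = productExp q (S.erase i) f η := fun η =>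
    productExp_congr_left fun j hj => by
      rw [Function.update_of_ne (Finset.ne_of_mem_erase hj)]
  rw [productExp_eq_erase hi, productExp_eq_erase hi, productExp_eq_erase hi (q := q)]
  simp only [hc, Function.update_self, Set.insert_idem]
  have h3 : productExp q (S.erase i) f η ≤ productExp q (S.erase i) f (insert i η) :=
    productExp_mono_set (fun j hj => hq j (Finset.mem_of_mem_erase hj)) hf (Set.subset_insert i η)
  -- Two independent trials `ε` and `q i - ε` succeed at least once with probability `q i - ε * (q i
  -- - ε) ≤ q i`.
  nlinarith [hq i hi, mul_nonneg hε (sub_nonneg.2 hεq),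
    mul_nonneg (mul_nonneg hε (sub_nonneg.2 hεq)) (sub_nonneg.2 h3)]

/-- Each coordinate of `Q` trades `ε` for an additional trial. With probability `ε ^ Q.card` all
these trials succeed; otherwise they are all discarded, which only lowers a monotone expectation. -/
theorem productExp_sprinkle_finset (hq : ∀ i, 0 ≤ q i ∧ q i ≤ 1) (hf : Monotone f)
    {Q : Finset ι} (hQ : Q ⊆ S) {ε : ℝ} (hε : 0 ≤ ε) (hε1 : ε ≤ 1) (hεq : ∀ i ∈ Q, ε ≤ q i) :
    ε ^ Q.card * productExp (fun i => if i ∈ Q then q i - ε else q i) S f (η ∪ ↑Q)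
      + (1 - ε ^ Q.card) * productExp (fun i => if i ∈ Q then q i - ε else q i) S f η
        ≤ productExp q S f η := by
  induction Q using Finset.induction_on with
  | empty => simp
  | insert i Q hi ih =>
    have ih := ih (fun j hj => hQ (Finset.mem_insert_of_mem hj))
      fun j hj => hεq j (Finset.mem_insert_of_mem hj)
    set q0 : ι → ℝ := fun j => if j ∈ Q then q j - ε else q j with hq0
    have hq0i : q0 i = q i := by simp [hq0, hi]
    have hqu : (fun j => if j ∈ insert i Q then q j - ε else q j)
        = Function.update q0 i (q0 i - ε) := by
      funext j
      by_cases hj : j = i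
      · subst hj; simp [hq0i]
      · simp [hq0, hj]
    have hq01 : ∀ j, 0 ≤ q0 j ∧ q0 j ≤ 1 := by
      intro j
      simp only [hq0]
      split_ifs with hj
      · have := hεq j (Finset.mem_insert_of_mem hj)
        constructor <;> linarith [(hq j).2]
      · exact hq j
    have hεi := hεq i (Finset.mem_insert_self i Q)
    have hq1 : ∀ j, 0 ≤ Function.update q0 i (q0 i - ε) j
        ∧ Function.update q0 i (q0 i - ε) j ≤ 1 := by
      intro j
      by_cases hj : j = i
      · subst hj
        rw [Function.update_self, hq0i]
        constructor <;> linarith [(hq j).2]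
      · rw [Function.update_of_ne hj]; exact hq01 j
    rw [hqu, Finset.card_insert_of_notMem hi]
    set q1 := Function.update q0 i (q0 i - ε)
    have h1 := productExp_sprinkle (fun j _ => hq01 j) hf (hQ (Finset.mem_insert_self i Q))
      hε (hq0i ▸ hεi) (η := η ∪ ↑Q) (q := q0)
    have h2 := productExp_sprinkle (fun j _ => hq01 j) hf (hQ (Finset.mem_insert_self i Q))
      hε (hq0i ▸ hεi) (η := η) (q := q0)
    have h3 : insert i (η ∪ (↑Q : Set ι)) = η ∪ ↑(insert i Q) := by
      ext j; simp
    rw [h3] at h1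
    have h4 : productExp q1 S f η ≤ productExp q1 S f (η ∪ ↑Q) :=
      productExp_mono_set (fun j _ => hq1 j) hf Set.subset_union_left
    have h5 : productExp q1 S f η ≤ productExp q1 S f (insert i η) :=
      productExp_mono_set (fun j _ => hq1 j) hf (Set.subset_insert i η)
    have h6 : (0 : ℝ) ≤ ε ^ Q.card := pow_nonneg hε _
    have h7 : ε ^ Q.card ≤ 1 := pow_le_one₀ hε hε1
    have h8 : productExp q1 S f η ≤ productExp q0 S f η := by
      nlinarith [mul_nonneg hε (sub_nonneg.2 h5)]
    have h9 : ε * productExp q1 S f (η ∪ ↑(insert i Q)) + (1 - ε) * productExp q1 S f η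
        ≤ productExp q0 S f (η ∪ ↑Q) := by
      nlinarith [mul_nonneg (sub_nonneg.2 hε1) (sub_nonneg.2 h4)]
    calc _ = ε ^ Q.card * (ε * productExp q1 S f (η ∪ ↑(insert i Q))
            + (1 - ε) * productExp q1 S f η) + (1 - ε ^ Q.card) * productExp q1 S f η := by
          rw [pow_succ]; ring
      _ ≤ ε ^ Q.card * productExp q0 S f (η ∪ ↑Q) + (1 - ε ^ Q.card) * productExp q0 S f η :=
          add_le_add (mul_le_mul_of_nonneg_left h9 h6)
            (mul_le_mul_of_nonneg_left h8 (by linarith))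
      _ ≤ _ := ih

/-- By monotonicity every configuration contributes nonnegatively to the difference, and `B₀` alone
has weight at least `m ^ S.card`. -/
theorem pow_card_le_productExp_sub {m : ℝ} (hm : 0 ≤ m) (hq : ∀ i ∈ S, m ≤ q i ∧ q i ≤ 1 - m)
    (hf : Monotone f) (hη : η ⊆ η') {B₀ : Finset ι} (hB : B₀ ⊆ S)
    (h1 : 1 ≤ f (η' ∪ ↑B₀) - f (η ∪ ↑B₀)) :
    m ^ S.card ≤ productExp q S f η' - productExp q S f η := by
  unfold productExp
  rw [← Finset.sum_sub_distrib]
  have hw : ∀ B ∈ S.powerset, m ^ S.card ≤ (∏ i ∈ B, q i) * ∏ i ∈ S \ B, (1 - q i) := by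
    intro B hB
    have hBS := Finset.mem_powerset.1 hB
    have hcard : S.card = B.card + (S \ B).card := by
      rw [add_comm, Finset.card_sdiff_add_card_eq_card hBS]
    rw [hcard, pow_add]
    refine mul_le_mul ?_ ?_ (pow_nonneg hm _) ?_
    · rw [← Finset.prod_const]
      exact Finset.prod_le_prod (fun _ _ => hm) fun i hi => (hq i (hBS hi)).1
    · rw [← Finset.prod_const]
      exact Finset.prod_le_prod (fun _ _ => hm) fun i hi => by
        linarith [(hq i (Finset.mem_sdiff.1 hi).1).2]
    · exact Finset.prod_nonneg fun i hi => hm.trans (hq i (hBS hi)).1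
  have hmp : 0 ≤ m ^ S.card := pow_nonneg hm _
  refine le_trans ?_ (Finset.single_le_sum (f := fun B : Finset ι =>
    (∏ i ∈ B, q i) * (∏ i ∈ S \ B, (1 - q i)) * f (η' ∪ ↑B)
      - (∏ i ∈ B, q i) * (∏ i ∈ S \ B, (1 - q i)) * f (η ∪ ↑B)) ?_ (Finset.mem_powerset.2 hB))
  · have := hw B₀ (Finset.mem_powerset.2 hB)
    simp only [← mul_sub]
    nlinarith
  · intro B hB
    simp only [← mul_sub]
    exact mul_nonneg (hmp.trans (hw B hB))
      (sub_nonneg.2 (hf (Set.union_subset_union_left _ hη)))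

/-- If every pivotality of the coordinate `e` can be turned, by changes inside the window `T`, into
a pivotality of some coordinate in `C`, then a small decrease of the parameter of `e` is compensated
by an increase of the parameters of `C`. -/
theorem productExp_exchange {A : Set (Set ι)} (hA : IsUpperSet A) {T C : Finset ι} (hT : T ⊆ S)
    {e : ι} (he : e ∈ T) (hC : C ⊆ T) (heC : e ∉ C)
    (hmod : ∀ η : Set ι, Disjoint η ↑T → ∀ B ⊆ T, η ∪ ↑B ∉ A → insert e (η ∪ ↑B) ∈ A →
      ∃ c ∈ C, ∃ B' ⊆ T, η ∪ ↑B' ∉ A ∧ insert c (η ∪ ↑B') ∈ A)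
    {m δ t : ℝ} (hm : 0 ≤ m) (hm1 : m ≤ 1) (hδ : 0 ≤ δ) (ht : 0 ≤ t) (hδt : δ ≤ t * m ^ T.card)
    (hq : ∀ i ∈ S, 0 ≤ q i ∧ q i ≤ 1) (hq' : ∀ i ∈ S, 0 ≤ q' i ∧ q' i ≤ 1)
    (hqT : ∀ i ∈ T, m ≤ q i ∧ q i ≤ 1 - m) (hqe : m ≤ q' e)
    (hqδ : q' e = q e - δ) (hqC : ∀ c ∈ C, q c + t ≤ q' c) (hqq : ∀ i ∈ S, i ≠ e → q i ≤ q' i)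
    (hqS : ∀ i ∈ S \ T, q i = q' i) :
    productExp q S (A.indicator 1) ∅ ≤ productExp q' S (A.indicator 1) ∅ := by
  set f : Set ι → ℝ := A.indicator 1 with hf_def
  have hf : Monotone f := monotone_indicator_one hA
  rw [← Finset.sdiff_union_of_subset hT, productExp_union Finset.sdiff_disjoint,
    productExp_union Finset.sdiff_disjoint, productExp_congr_left hqS]
  -- Condition on the coordinates outside the window, whose law is unchanged; `η` records the open
  -- ones.
  refine productExp_le (fun i hi => hq' i (Finset.mem_sdiff.1 hi).1) fun B₁ hB₁ => ?_
  rw [Set.empty_union]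
  set η : Set ι := ↑B₁
  have hη : Disjoint η ↑T := by
    rw [Finset.disjoint_coe]
    exact Finset.disjoint_of_subset_left hB₁ Finset.sdiff_disjoint
  set q₁ : ι → ℝ := Function.update q e (q e - δ) with hq₁
  have hq₁' : ∀ i ∈ T, m ≤ q₁ i ∧ q₁ i ≤ 1 - m := by
    intro i hi
    by_cases hie : i = e
    · subst hie
      rw [hq₁, Function.update_self]
      exact ⟨hqδ ▸ hqe, by linarith [(hqT i hi).2]⟩
    · rw [hq₁, Function.update_of_ne hie]; exact hqT i hi
  have hq₁01 : ∀ i ∈ T, 0 ≤ q₁ i ∧ q₁ i ≤ 1 := fun i hi => by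
    have := hq₁' i hi; constructor <;> linarith
  have hq₁q' : ∀ i ∈ T, q₁ i ≤ q' i := by
    intro i hi
    by_cases hie : i = e
    · subst hie; rw [hq₁, Function.update_self, hqδ]
    · rw [hq₁, Function.update_of_ne hie]; exact hqq i (hT hi) hie
  have hcongr : ∀ η, productExp q₁ (T.erase e) f η = productExp q (T.erase e) f η := fun η =>
    productExp_congr_left fun j hj => by
      rw [hq₁, Function.update_of_ne (Finset.ne_of_mem_erase hj)]
  have hT' : ∀ i ∈ T.erase e, 0 ≤ q i ∧ q i ≤ 1 := fun i hi =>
    hq i (hT (Finset.mem_of_mem_erase hi))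
  have hdiff : productExp q T f η - productExp q₁ T f η
      = δ * (productExp q (T.erase e) f (insert e η) - productExp q (T.erase e) f η) := by
    rw [productExp_eq_erase he, productExp_eq_erase he, hcongr, hcongr, hq₁, Function.update_self]
    ring
  -- Given `η`, either `e` can be pivotal, and then the loss is at most `δ` while raising a single
  -- `c ∈ C` by `t` gains at least `t * m ^ T.card`; or the parameter of `e` does not matter.
  by_cases hpiv : ∃ B ⊆ T, η ∪ ↑B ∉ A ∧ insert e (η ∪ ↑B) ∈ A
  · obtain ⟨B, hB, hBA, hBA'⟩ := hpiv
    obtain ⟨c, hc, B', hB', hcA, hcA'⟩ := hmod η hη B hB hBA hBA'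
    have hcT := hC hc
    have hce : c ≠ e := fun h => heC (h ▸ hc)
    have hcB : c ∉ B' := fun h => hcA (by
      rwa [Set.insert_eq_of_mem (Set.mem_union_right η (Finset.mem_coe.2 h))] at hcA')
    set q₂ : ι → ℝ := Function.update q₁ c (q c + t) with hq₂
    have hq₁c : q₁ c = q c := by rw [hq₁, Function.update_of_ne hce]
    have hq₂q' : ∀ i ∈ T, q₂ i ≤ q' i := by
      intro i hi
      by_cases hic : i = c
      · subst hic; rw [hq₂, Function.update_self]; exact hqC i hc
      · rw [hq₂, Function.update_of_ne hic]; exact hq₁q' i hi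
    have hq₂01 : ∀ i ∈ T, 0 ≤ q₂ i ∧ q₂ i ≤ 1 := by
      intro i hi
      refine ⟨?_, (hq₂q' i hi).trans (hq' i (hT hi)).2⟩
      by_cases hic : i = c
      · subst hic; rw [hq₂, Function.update_self]; linarith [(hq i (hT hi)).1]
      · rw [hq₂, Function.update_of_ne hic]; exact (hq₁01 i hi).1
    have hcongr₂ : ∀ η, productExp q₂ (T.erase c) f η = productExp q₁ (T.erase c) f η := fun η =>
      productExp_congr_left fun j hj => by
        rw [hq₂, Function.update_of_ne (Finset.ne_of_mem_erase hj)]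
    have hdiff₂ : productExp q₂ T f η - productExp q₁ T f η
        = t * (productExp q₁ (T.erase c) f (insert c η) - productExp q₁ (T.erase c) f η) := by
      rw [productExp_eq_erase hcT, productExp_eq_erase hcT, hcongr₂, hcongr₂, hq₂,
        Function.update_self, hq₁c]
      ring
    have hgain : m ^ (T.erase c).card
        ≤ productExp q₁ (T.erase c) f (insert c η) - productExp q₁ (T.erase c) f η := by
      refine pow_card_le_productExp_sub hm (fun i hi => hq₁' i (Finset.mem_of_mem_erase hi)) hf
        (Set.subset_insert c η) (B₀ := B')
        (fun j hj => Finset.mem_erase.2 ⟨fun h => hcB (h ▸ hj), hB' hj⟩) ?_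
      rw [Set.insert_union, hf_def, Set.indicator_of_mem hcA', Set.indicator_of_notMem hcA]
      simp
    have hpow : m ^ T.card ≤ m ^ (T.erase c).card :=
      pow_le_pow_of_le_one hm hm1 (Finset.card_le_card (Finset.erase_subset c T))
    have hloss : productExp q (T.erase e) f (insert e η) - productExp q (T.erase e) f η ≤ 1 := by
      have h1 : productExp q (T.erase e) f (insert e η) ≤ 1 :=
        productExp_le_one hT' (indicator_one_le_one A)
      have h2 : 0 ≤ productExp q (T.erase e) f η :=
        productExp_nonneg hT' (indicator_one_nonneg A)
      linarith
    have hfin : productExp q₂ T f η ≤ productExp q' T f η :=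
      productExp_mono_left hq₂01 (fun i hi => hq' i (hT hi)) hf hq₂q'
    have := mul_le_mul_of_nonneg_left hloss hδ
    have := mul_le_mul_of_nonneg_left (hpow.trans hgain) ht
    linarith
  · have h0 : productExp q (T.erase e) f (insert e η) = productExp q (T.erase e) f η := by
      refine productExp_congr fun B hB => ?_
      have hBT : B ⊆ T := hB.trans (Finset.erase_subset e T)
      rw [Set.insert_union]
      by_cases hBA : η ∪ ↑B ∈ A
      · have := hA (Set.subset_insert e _) hBA
        rw [hf_def, Set.indicator_of_mem hBA, Set.indicator_of_mem this]
        rfl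
      · have : insert e (η ∪ ↑B) ∉ A := fun h => hpiv ⟨B, hBT, hBA, h⟩
        rw [hf_def, Set.indicator_of_notMem hBA, Set.indicator_of_notMem this]
    rw [h0, sub_self, mul_zero, sub_eq_zero] at hdiff
    rw [hdiff]
    exact productExp_mono_left hq₁01 (fun i hi => hq' i (hT hi)) hf hq₁q'

end ProductExp
end BondPercolation

/-! ### Balls in graphs of bounded degree -/

namespace BondPercolation

section Balls

variable {W : Type*} {H : SimpleGraph W}

theorem exists_adj_dist_eq (hH : H.Connected) {x y : W} {k : ℕ} (h : H.dist x y = k + 1) :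
    ∃ z, H.Adj z y ∧ H.dist x z = k := by
  obtain ⟨p, hp⟩ := hH.exists_walk_length_eq_dist y x
  rw [SimpleGraph.dist_comm, h] at hp
  cases p with
  | nil => simp at hp
  | @cons _ z _ hyz p =>
    refine ⟨z, hyz.symm, ?_⟩
    have h1 : H.dist z x ≤ k := (SimpleGraph.dist_le p).trans (by simpa using hp.le)
    have h2 : H.dist x y ≤ H.dist x z + 1 :=
      (hH.dist_triangle (v := z)).trans (by rw [SimpleGraph.dist_eq_one_iff_adj.2 hyz.symm])
    rw [SimpleGraph.dist_comm] at h1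
    omega

theorem dist_le_dist_add_one (hH : H.Connected) {y z : W} (x : W) (h : H.Adj y z) :
    H.dist x z ≤ H.dist x y + 1 :=
  (hH.dist_triangle (v := y)).trans (by rw [SimpleGraph.dist_eq_one_iff_adj.2 h])

theorem BoundedDegree.exists_ball (hH : H.Connected) (hd : BoundedDegree H) (k : ℕ) :
    ∃ N : ℕ, ∀ x, ∃ F : Finset W, F.card ≤ N ∧ ∀ y, y ∈ F ↔ H.dist x y ≤ k := by
  classical
  obtain ⟨D, hD⟩ := hd
  have hfin : ∀ x, (H.neighborSet x).Finite := fun x =>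
    Set.finite_of_encard_le_coe (hD x)
  have hcard : ∀ x, (hfin x).toFinset.card ≤ D := fun x => by
    have := hD x
    rw [(hfin x).encard_eq_coe_toFinset_card] at this
    exact_mod_cast this
  suffices hs : ∃ N : ℕ, ∀ x, ∃ F : Finset W, F.card ≤ N ∧ ∀ y, H.dist x y ≤ k → y ∈ F by
    obtain ⟨N, hN⟩ := hs
    refine ⟨N, fun x => ?_⟩
    obtain ⟨F, hF, hF'⟩ := hN x
    refine ⟨F.filter fun y => H.dist x y ≤ k, (Finset.card_filter_le _ _).trans hF, fun y => ?_⟩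
    simpa using hF' y
  induction k with
  | zero =>
    refine ⟨1, fun x => ⟨{x}, by simp, fun y hy => ?_⟩⟩
    rw [Nat.le_zero, hH.dist_eq_zero_iff] at hy
    simp [hy]
  | succ k ih =>
    obtain ⟨N, hN⟩ := ih
    refine ⟨N + N * D, fun x => ?_⟩
    obtain ⟨F, hF, hF'⟩ := hN x
    refine ⟨F ∪ F.biUnion fun y => (hfin y).toFinset, ?_, fun y hy => ?_⟩
    · refine (Finset.card_union_le _ _).trans (add_le_add hF ?_)
      exact (Finset.card_biUnion_le_card_mul _ _ _ fun y _ => hcard y).trans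
        (Nat.mul_le_mul_right _ hF)
    · rcases Nat.lt_or_ge k (H.dist x y) with h | h
      · obtain ⟨z, hz, hxz⟩ := exists_adj_dist_eq hH (le_antisymm hy h)
        exact Finset.mem_union_right _ (Finset.mem_biUnion.2 ⟨z, hF' z hxz.le, by simpa using hz⟩)
      · exact Finset.mem_union_left _ (hF' y h)

theorem BoundedDegree.exists_edgeBall (hH : H.Connected) (hd : BoundedDegree H) (k : ℕ) :
    ∃ N : ℕ, ∀ x, ∃ F : Finset (Sym2 W), F.card ≤ N ∧
      ∀ e, e ∈ F ↔ e ∈ H.edgeSet ∧ ∃ y ∈ e, H.dist x y ≤ k := by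
  classical
  obtain ⟨N, hN⟩ := hd.exists_ball hH (k + 1)
  refine ⟨N * N, fun x => ?_⟩
  obtain ⟨F, hF, hF'⟩ := hN x
  refine ⟨((F ×ˢ F).image fun z => s(z.1, z.2)).filter fun e =>
    e ∈ H.edgeSet ∧ ∃ y ∈ e, H.dist x y ≤ k, ?_, fun e => ?_⟩
  · refine (Finset.card_filter_le _ _).trans (Finset.card_image_le.trans ?_)
    rw [Finset.card_product]
    exact Nat.mul_le_mul hF hF
  · rw [Finset.mem_filter, and_iff_right_iff_imp]
    rintro ⟨he, y, hy, hxy⟩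
    induction e with | _ a b =>
    have hab : H.Adj a b := he
    rw [Finset.mem_image]
    refine ⟨(a, b), ?_, rfl⟩
    have := dist_le_dist_add_one hH x hab
    have := dist_le_dist_add_one hH x hab.symm
    rw [Finset.mem_product, hF', hF']
    rcases Sym2.mem_iff.1 hy with rfl | rfl <;> constructor <;> simp only <;> omega

theorem BoundedDegree.countable (hH : H.Connected) (hd : BoundedDegree H) : Countable W := by
  obtain ⟨x⟩ := hH.nonempty
  have h : (Set.univ : Set W) = ⋃ k, {y | H.dist x y ≤ k} := by
    ext y
    simp only [Set.mem_univ, Set.mem_iUnion, Set.mem_ofPred_eq, true_iff]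
    exact ⟨_, le_rfl⟩
  rw [← Set.countable_univ_iff, h]
  refine Set.countable_iUnion fun k => ?_
  obtain ⟨N, hN⟩ := hd.exists_ball hH k
  obtain ⟨F, -, hF⟩ := hN x
  exact (F.finite_toSet.subset fun y hy => (hF y).2 hy).countable

end Balls
end BondPercolation

/-! ### The enhanced model and pivotal activations -/

namespace BondPercolation

open Relation

section Enhancement

variable {W : Type*} {H : SimpleGraph W} {r n : ℕ} {o c : W} {ω ω' η : Set (Sym2 W ⊕ W)}

/-- All edges inside the ball of radius `r` around `c` are open in `ω`. -/
def BallOpen (H : SimpleGraph W) (r : ℕ) (ω : Set (Sym2 W ⊕ W)) (c : W) : Prop :=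
  ∀ x y, H.Adj x y → H.dist c x ≤ r → H.dist c y ≤ r → Sum.inl s(x, y) ∈ ω

/-- The steps of the enhanced model: besides the open edges, it is allowed to leave the ball of
radius `r` around an activated vertex `c` if this ball is fully open. -/
def EnhancedStep (H : SimpleGraph W) (r : ℕ) (ω : Set (Sym2 W ⊕ W)) (x y : W) : Prop :=
  H.Adj x y ∧ (Sum.inl s(x, y) ∈ ω ∨ ∃ c, Sum.inr c ∈ ω ∧ H.dist c x ≤ r ∧ BallOpen H r ω c)

/-- In the enhanced model, the vertex `o` is connected to distance `n`. -/
def enhancedReach (H : SimpleGraph W) (r : ℕ) (o : W) (n : ℕ) : Set (Set (Sym2 W ⊕ W)) :=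
  {ω | ∃ y, n ≤ H.dist o y ∧ ReflTransGen (EnhancedStep H r ω) o y}

theorem BallOpen.mono (h : ω ⊆ ω') (hb : BallOpen H r ω c) : BallOpen H r ω' c :=
  fun x y hxy hx hy => h (hb x y hxy hx hy)

theorem EnhancedStep.mono (h : ω ⊆ ω') {x y : W} (hs : EnhancedStep H r ω x y) :
    EnhancedStep H r ω' x y :=
  ⟨hs.1, hs.2.imp (fun he => h he) fun ⟨c, hc, hx, hb⟩ => ⟨c, h hc, hx, hb.mono h⟩⟩

theorem reflTransGen_enhancedStep_mono (h : ω ⊆ ω') {x y : W}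
    (hs : ReflTransGen (EnhancedStep H r ω) x y) : ReflTransGen (EnhancedStep H r ω') x y :=
  ReflTransGen.mono (fun _ _ => EnhancedStep.mono h) _ _ hs

theorem isUpperSet_enhancedReach : IsUpperSet (enhancedReach H r o n) :=
  fun _ _ h ⟨y, hy, hs⟩ => ⟨y, hy, reflTransGen_enhancedStep_mono h hs⟩

theorem BallOpen.reflTransGen (hH : H.Connected) (hb : BallOpen H r ω c) {x : W}
    (hx : H.dist c x ≤ r) :
    ReflTransGen (EnhancedStep H r ω) c x ∧ ReflTransGen (EnhancedStep H r ω) x c := by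
  generalize hk : H.dist c x = k at hx
  induction k generalizing x with
  | zero =>
    rw [hH.dist_eq_zero_iff] at hk
    subst hk
    exact ⟨.refl, .refl⟩
  | succ k ih =>
    obtain ⟨z, hzx, hz⟩ := exists_adj_dist_eq hH hk
    obtain ⟨h1, h2⟩ := ih hz (by omega)
    have he := hb z x hzx (by omega) (by omega)
    exact ⟨h1.tail ⟨hzx, Or.inl he⟩, h2.head ⟨hzx.symm, Or.inl (Sym2.eq_swap ▸ he)⟩⟩

/-- Add the elements of `F` one by one: one of the additions makes the configuration enter `A`. -/
theorem exists_pivotal {ι : Type*} [DecidableEq ι] {A : Set (Set ι)} {ω : Set ι} (F : Finset ι)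
    (h0 : ω ∉ A) (h1 : ω ∪ ↑F ∈ A) :
    ∃ c ∈ F, ∃ F' ⊆ F, ω ∪ ↑F' ∉ A ∧ insert c (ω ∪ ↑F') ∈ A := by
  induction F using Finset.induction_on with
  | empty => simp at h1; exact absurd h1 h0
  | insert i F hi ih =>
    by_cases h : ω ∪ ↑F ∈ A
    · obtain ⟨c, hc, F', hF', h⟩ := ih h
      exact ⟨c, Finset.mem_insert_of_mem hc, F', hF'.trans (Finset.subset_insert i F), h⟩
    · refine ⟨i, Finset.mem_insert_self i F, F, Finset.subset_insert i F, h, ?_⟩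
      have : insert i (ω ∪ (↑F : Set ι)) = ω ∪ ↑(insert i F) := by ext j; simp
      rwa [this]

open scoped Classical in
/-- The case of `exists_pivotal_activation` where no vertex of the window is activated. -/
theorem exists_pivotal_center (hH : H.Connected) (hn : H.dist o c + r < n)
    {T : Finset (Sym2 W ⊕ W)}
    (hTe : ∀ e, Sum.inl e ∈ T ↔ e ∈ H.edgeSet ∧ ∃ y ∈ e, H.dist c y ≤ r)
    (hTv : ∀ v, Sum.inr v ∈ T ↔ H.dist c v ≤ 2 * r)
    (hη : Disjoint η ↑T) {ω : Set (Sym2 W ⊕ W)}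
    (hω : ∀ i ∈ ω, i ∈ η ∨ ∃ e, i = Sum.inl e ∧ i ∈ T) (hη0 : η ∉ enhancedReach H r o n)
    (h1 : ω ∈ enhancedReach H r o n) :
    ∃ B ⊆ T, η ∪ ↑B ∉ enhancedReach H r o n ∧
      insert (Sum.inr c) (η ∪ ↑B) ∈ enhancedReach H r o n := by
  have hηT : ∀ {i}, i ∈ η → i ∉ T := fun hi hT => Set.disjoint_left.1 hη hi hT
  have htouch : ∀ {x y}, Sum.inl s(x, y) ∈ T → H.dist c x ≤ r ∨ H.dist c y ≤ r := by
    intro x y h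
    obtain ⟨-, z, hz, hcz⟩ := (hTe _).1 h
    rcases Sym2.mem_iff.1 hz with rfl | rfl
    · exact Or.inl hcz
    · exact Or.inr hcz
  have hfar : ∀ {v z}, Sum.inr v ∈ η → H.dist v z ≤ r → r < H.dist c z := by
    intro v z hv hvz
    by_contra! hcz
    refine hηT hv ((hTv v).2 ?_)
    have := hH.dist_triangle (u := c) (v := z) (w := v)
    rw [SimpleGraph.dist_comm (u := z)] at this
    omega
  -- Vertices activated in `η` are further than `2 * r` from `c`, so their balls use no edge of the
  -- window. Changing window edges therefore affects only steps along those edges.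
  have hstep : ∀ {ω' : Set (Sym2 W ⊕ W)}, (∀ i ∈ ω', i ∈ η ∨ ∃ e, i = Sum.inl e ∧ i ∈ T) →
      ∀ {x y}, EnhancedStep H r ω' x y → EnhancedStep H r η x y ∨
        (H.Adj x y ∧ Sum.inl s(x, y) ∈ ω' ∧ Sum.inl s(x, y) ∈ T) := by
    rintro ω' hω' x y ⟨hxy, he | ⟨v, hv, hvx, hb⟩⟩
    · rcases hω' _ he with h | ⟨_, -, h⟩
      · exact Or.inl ⟨hxy, Or.inl h⟩
      · exact Or.inr ⟨hxy, he, h⟩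
    · have hvη : Sum.inr v ∈ η := by
        rcases hω' _ hv with h | ⟨_, h, -⟩
        · exact h
        · cases h
      refine Or.inl ⟨hxy, Or.inr ⟨v, hvη, hvx, fun a b hab ha hb' => ?_⟩⟩
      rcases hω' _ (hb a b hab ha hb') with h | ⟨_, -, h⟩
      · exact h
      · rcases htouch h with h | h
        · exact absurd (hfar hvη ha) (by omega)
        · exact absurd (hfar hvη hb') (by omega)
  -- Enhanced steps are directed, so `D` collects the vertices that lead to distance `n` in `η`. The
  -- ball around `c` avoids it: in `η` no step leaves a vertex of this ball, which is too close to
  -- `o` to be a target itself.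
  set D : Set W := {v | ∃ y, n ≤ H.dist o y ∧ ReflTransGen (EnhancedStep H r η) v y} with hD
  have hoD : o ∉ D := hη0
  have hDstep : ∀ {x y}, EnhancedStep H r η x y → y ∈ D → x ∈ D :=
    fun hxy ⟨z, hz, hyz⟩ => ⟨z, hz, hyz.head hxy⟩
  have hDZ : ∀ v, H.dist c v ≤ r → v ∉ D := by
    rintro v hv ⟨y, hy, hvy⟩
    rcases hvy.cases_head with rfl | ⟨w, ⟨hvw, h | ⟨c', hc', hc'v, -⟩⟩, -⟩
    · have := hH.dist_triangle (u := o) (v := c) (w := v)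
      omega
    · exact hηT h ((hTe _).2 ⟨hvw, v, Sym2.mem_mk_left v w, hv⟩)
    · exact absurd (hfar hc' hc'v) (by omega)
  obtain ⟨y, hy, hoy⟩ := h1
  -- The start of the path, until its first step along a window edge, is available in `η` and leads
  -- to the ball or next to it.
  have hfirst : ∃ x, ReflTransGen (EnhancedStep H r η) o x ∧
      (H.dist c x ≤ r ∨ ∃ z, H.Adj x z ∧ H.dist c z ≤ r) := by
    have : ReflTransGen (EnhancedStep H r η) o y ∨ ∃ x, ReflTransGen (EnhancedStep H r η) o x ∧
        (H.dist c x ≤ r ∨ ∃ z, H.Adj x z ∧ H.dist c z ≤ r) := by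
      clear hy
      induction hoy with
      | refl => exact Or.inl .refl
      | @tail a b _ hab ih =>
        rcases ih with ih | ih
        · rcases hstep hω hab with h | ⟨hadj, -, h⟩
          · exact Or.inl (ih.tail h)
          · exact Or.inr ⟨a, ih, (htouch h).imp id fun h => ⟨b, hadj, h⟩⟩
        · exact Or.inr ih
    exact this.resolve_left fun h => hoD ⟨y, hy, h⟩
  -- Symmetrically, read from its end, the path enters `D` by a window edge after which `η`
  -- suffices.
  have hlast : ∃ x z, H.Adj x z ∧ z ∈ D ∧ (H.dist c x ≤ r ∨ H.dist c z ≤ r) := by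
    have : ∀ w, ReflTransGen (EnhancedStep H r ω) w y →
        w ∈ D ∨ ∃ x z, H.Adj x z ∧ z ∈ D ∧ (H.dist c x ≤ r ∨ H.dist c z ≤ r) := by
      intro w hwy
      induction hwy using ReflTransGen.head_induction_on with
      | refl => exact Or.inl ⟨y, hy, .refl⟩
      | @head a b hab _ ih =>
        rcases ih with ih | ih
        · rcases hstep hω hab with h | ⟨hadj, -, h⟩
          · exact Or.inl (hDstep h ih)
          · exact Or.inr ⟨a, b, hadj, ih, htouch h⟩
        · exact Or.inr ih
    exact (this o hoy).resolve_left hoD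
  obtain ⟨x₀, hox₀, hx₀⟩ := hfirst
  obtain ⟨x₁, y₁, hadj₁, hy₁, hx₁⟩ := hlast
  replace hx₁ : H.dist c x₁ ≤ r := hx₁.resolve_right fun h => hDZ y₁ h hy₁
  have hx₀D : x₀ ∉ D := fun ⟨z, hz, h⟩ => hoD ⟨z, hz, hox₀.trans h⟩
  -- Open the whole ball and its links to `x₀`, but no other exit. No opened edge has an endpoint in
  -- `D`, so distance `n` stays out of reach; activating `c` then allows the step from `x₁` to `y₁ ∈
  -- D`.
  set B := T.filter fun i => ∃ u v, i = Sum.inl s(u, v) ∧ H.dist c u ≤ r ∧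
    (H.dist c v ≤ r ∨ v = x₀) with hB
  have hBT : B ⊆ T := Finset.filter_subset _ _
  refine ⟨B, hBT, ?_, ?_⟩
  · rintro ⟨y, hy, hoy⟩
    have hωB : ∀ i ∈ η ∪ ↑B, i ∈ η ∨ ∃ e, i = Sum.inl e ∧ i ∈ T := by
      rintro i (hi | hi)
      · exact Or.inl hi
      · obtain ⟨hiT, u, v, rfl, -⟩ := Finset.mem_filter.1 hi
        exact Or.inr ⟨_, rfl, hiT⟩
    have : y ∉ D := by
      clear hy
      induction hoy with
      | refl => exact hoD
      | @tail a b _ hab ih =>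
        rcases hstep hωB hab with h | ⟨-, h, hT⟩
        · exact fun hb => ih (hDstep h hb)
        · have hBab := h.resolve_left fun h => hηT h hT
          obtain ⟨-, u, v, huv, hu, hv⟩ := Finset.mem_filter.1 hBab
          have hvD : v ∉ D := by
            rcases hv with hv | rfl
            · exact hDZ v hv
            · exact hx₀D
          rcases Sym2.eq_iff.1 (Sum.inl_injective huv) with ⟨rfl, rfl⟩ | ⟨rfl, rfl⟩
          · exact hvD
          · exact hDZ _ hu
    exact this ⟨y, hy, .refl⟩
  · set ω' := insert (Sum.inr c) (η ∪ (↑B : Set (Sym2 W ⊕ W)))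
    have hηω' : η ⊆ ω' := fun i hi => Or.inr (Or.inl hi)
    have hBω' : ∀ {i}, i ∈ B → i ∈ ω' := fun hi => Or.inr (Or.inr hi)
    have hball : BallOpen H r ω' c := fun x y hxy hx hy =>
      hBω' (Finset.mem_filter.2 ⟨(hTe _).2 ⟨hxy, x, Sym2.mem_mk_left x y, hx⟩,
        x, y, rfl, hx, Or.inl hy⟩)
    obtain ⟨y, hy, hy₁y⟩ := hy₁
    refine ⟨y, hy, ?_⟩
    have h1 : ReflTransGen (EnhancedStep H r ω') o c := by
      refine (reflTransGen_enhancedStep_mono hηω' hox₀).trans ?_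
      rcases hx₀ with h | ⟨z, hadj, hz⟩
      · exact (hball.reflTransGen hH h).2
      · refine ReflTransGen.head ⟨hadj, Or.inl (hBω' (Finset.mem_filter.2 ⟨(hTe _).2
          ⟨hadj, z, Sym2.mem_mk_right x₀ z, hz⟩, z, x₀, ?_, hz, Or.inr rfl⟩))⟩
          (hball.reflTransGen hH hz).2
        rw [Sym2.eq_swap]
    refine h1.trans ((hball.reflTransGen hH hx₁).1.trans ?_)
    exact ReflTransGen.head ⟨hadj₁, Or.inr ⟨c, Set.mem_insert _ _, hx₁, hball⟩⟩
      (reflTransGen_enhancedStep_mono hηω' hy₁y)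

-- Split `B` into edges and activations. If the edges suffice once `e` is open, then `c` can be made
-- pivotal by `exists_pivotal_center`. Otherwise, with `e` open, some activation of `B` is pivotal
-- when these are added one by one.
open scoped Classical in
theorem exists_pivotal_activation (hH : H.Connected) (hn : H.dist o c + r < n)
    {T : Finset (Sym2 W ⊕ W)}
    (hTe : ∀ e, Sum.inl e ∈ T ↔ e ∈ H.edgeSet ∧ ∃ y ∈ e, H.dist c y ≤ r)
    (hTv : ∀ v, Sum.inr v ∈ T ↔ H.dist c v ≤ 2 * r)
    (hη : Disjoint η ↑T) {e : Sym2 W} (he : Sum.inl e ∈ T) {B : Finset (Sym2 W ⊕ W)} (hB : B ⊆ T)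
    (h0 : η ∪ ↑B ∉ enhancedReach H r o n)
    (h1 : insert (Sum.inl e) (η ∪ ↑B) ∈ enhancedReach H r o n) :
    ∃ v, Sum.inr v ∈ T ∧ ∃ B' ⊆ T, η ∪ ↑B' ∉ enhancedReach H r o n ∧
      insert (Sum.inr v) (η ∪ ↑B') ∈ enhancedReach H r o n := by
  set B₁ := B.filter fun i => ∃ e, i = Sum.inl e with hB₁
  set B₂ := B.filter fun i => ¬ ∃ e, i = Sum.inl e with hB₂
  have hB₁B : B₁ ⊆ B := Finset.filter_subset _ _
  have hB₂B : B₂ ⊆ B := Finset.filter_subset _ _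
  by_cases h : insert (Sum.inl e) (η ∪ ↑B₁) ∈ enhancedReach H r o n
  · have hη0 : η ∉ enhancedReach H r o n := fun h' =>
      h0 (isUpperSet_enhancedReach Set.subset_union_left h')
    have hω : ∀ i ∈ insert (Sum.inl e) (η ∪ ↑B₁), i ∈ η ∨ ∃ e, i = Sum.inl e ∧ i ∈ T := by
      rintro i (rfl | hi | hi)
      · exact Or.inr ⟨e, rfl, he⟩
      · exact Or.inl hi
      · obtain ⟨hiB, e', rfl⟩ := Finset.mem_filter.1 hi
        exact Or.inr ⟨e', rfl, hB hiB⟩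
    obtain ⟨B', hB', h'⟩ := exists_pivotal_center hH hn hTe hTv hη hω hη0 h
    exact ⟨c, (hTv c).2 (by simp), B', hB', h'⟩
  · have hu : insert (Sum.inl e) (η ∪ ↑B₁) ∪ ↑B₂ = insert (Sum.inl e) (η ∪ ↑B) := by
      ext i
      simp only [hB₁, hB₂, Finset.coe_filter, Set.mem_union, Set.mem_insert_iff, Set.mem_ofPred_eq,
        Finset.mem_coe]
      tauto
    obtain ⟨i, hi, F', hF', h2, h3⟩ := exists_pivotal B₂ h (hu ▸ h1)
    have hiB := Finset.mem_filter.1 hi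
    rcases i with e' | v
    · exact absurd ⟨e', rfl⟩ hiB.2
    · have hu' : insert (Sum.inl e) (η ∪ ↑B₁) ∪ ↑F' = η ∪ ↑(insert (Sum.inl e) (B₁ ∪ F')) := by
        ext i
        simp only [Set.mem_union, Set.mem_insert_iff, Finset.coe_insert, Finset.coe_union,
          Finset.mem_coe]
        tauto
      rw [hu'] at h2 h3
      refine ⟨v, hB hiB.1, _, ?_, h2, h3⟩
      intro j hj
      rcases Finset.mem_insert.1 hj with rfl | hj
      · exact he
      · rcases Finset.mem_union.1 hj with hj | hj
        · exact hB (hB₁B hj)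
        · exact hB (hB₂B (hF' hj))

end Enhancement
end BondPercolation

/-! ### Trading edge parameter for activation density -/

namespace BondPercolation

open Relation

section Comparison

variable {W : Type*} {H : SimpleGraph W} {r n : ℕ} {o : W}

/-- Steps are needed only from vertices at distance less than `n` from `o`, and an enhanced step
looks at edges within `2 * r` of its starting point. -/
theorem enhancedReach_inter (hH : H.Connected) {ω : Set (Sym2 W ⊕ W)}
    {K : Set (Sym2 W ⊕ W)}
    (hKe : ∀ e ∈ H.edgeSet, (∃ y ∈ e, H.dist o y ≤ n + 2 * r) → Sum.inl e ∈ K)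
    (hKv : ∀ v, Sum.inr v ∈ K) (hω : ω ∈ enhancedReach H r o n) :
    ω ∩ K ∈ enhancedReach H r o n := by
  obtain ⟨y, hy, hoy⟩ := hω
  have : ω ∩ K ∈ enhancedReach H r o n ∨ ReflTransGen (EnhancedStep H r (ω ∩ K)) o y := by
    clear hy
    induction hoy with
    | refl => exact Or.inr .refl
    | @tail a b _ hab ih =>
      rcases ih with ih | ih
      · exact Or.inl ih
      by_cases ha : n ≤ H.dist o a
      · exact Or.inl ⟨a, ha, ih⟩
      refine Or.inr (ih.tail ⟨hab.1, ?_⟩)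
      rcases hab with ⟨hadj, he | ⟨c, hc, hca, hb⟩⟩
      · exact Or.inl ⟨he, hKe _ hadj ⟨a, Sym2.mem_mk_left a b, by omega⟩⟩
      · refine Or.inr ⟨c, ⟨hc, hKv c⟩, hca, fun x z hxz hx hz => ⟨hb x z hxz hx hz,
          hKe _ hxz ⟨x, Sym2.mem_mk_left x z, ?_⟩⟩⟩
        have h1 := hH.dist_triangle (u := o) (v := a) (w := x)
        have h2 := hH.dist_triangle (u := a) (v := c) (w := x)
        rw [SimpleGraph.dist_comm (u := a) (v := c)] at h2
        omega
  exact this.elim id fun h => ⟨y, hy, h⟩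

theorem enhancedReach_anti {n' : ℕ} (h : n ≤ n') : enhancedReach H r o n' ⊆ enhancedReach H r o n :=
  fun _ ⟨y, hy, hs⟩ => ⟨y, h.trans hy, hs⟩

open scoped Classical in
/-- Decreasing the edge parameter by a small `δ` is compensated by the enhancement. -/
theorem exists_enhancement_gain (hH : H.Connected) (hd : BoundedDegree H) (r : ℕ) {m : ℝ}
    (hm : 0 < m) (hm3 : m ≤ 1 / 3) :
    ∃ δ > 0, δ ≤ m ∧ ∀ p, m ≤ p → p + δ ≤ 1 - m → ∀ (o : W) (n : ℕ) (F : Finset (Sym2 W)),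
      ↑F ⊆ H.edgeSet → ∃ S : Finset (Sym2 W ⊕ W), (∀ e, Sum.inl e ∈ S → e ∈ H.edgeSet) ∧
      productExp (Sum.elim (fun _ => p + δ) fun _ => 0) (F.map .inl)
          ((enhancedReach H r o (n + 3 * r + 2)).indicator 1) ∅
        ≤ productExp (Sum.elim (fun _ => p) fun _ => 2 * m) S
          ((enhancedReach H r o n).indicator 1) ∅ := by
  obtain ⟨N₁, hN₁⟩ := hd.exists_edgeBall hH r
  obtain ⟨N₂, hN₂⟩ := hd.exists_ball hH (2 * r)
  obtain ⟨N₃, hN₃⟩ := hd.exists_edgeBall hH (2 * r)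
  choose E hEc hE using hN₁
  choose B hBc hB using hN₂
  -- At most `N₃` edges have a given vertex in their window, so the increments `t` at this vertex
  -- add up to at most `m`.
  set t : ℝ := m / (N₃ + 1) with ht_def
  have ht : 0 < t := by positivity
  have htN : t * N₃ ≤ m := by
    rw [ht_def, div_mul_eq_mul_div, div_le_iff₀ (by positivity)]
    nlinarith
  have htm : t ≤ m := div_le_self hm.le (by linarith [N₃.cast_nonneg (α := ℝ)])
  -- A window has at most `N₁ + N₂` coordinates, so this `δ` meets the requirement of
  -- `productExp_exchange`.
  refine ⟨t * m ^ (N₁ + N₂), by positivity, (mul_le_of_le_one_right ht.le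
    (pow_le_one₀ hm.le (by linarith))).trans htm, fun p hmp hpm o n F hF => ?_⟩
  set δ : ℝ := t * m ^ (N₁ + N₂) with hδ_def
  have hδ : 0 < δ := by positivity
  obtain ⟨_, hK⟩ := hd.exists_edgeBall hH (n + 2 * r)
  obtain ⟨K, -, hK⟩ := hK o
  have hcen : ∀ e : Sym2 W, ∃ c, c ∈ e := fun e => ⟨_, e.out_fst_mem⟩
  choose cen hcen using hcen
  set T : Sym2 W → Finset (Sym2 W ⊕ W) := fun e => (E (cen e)).disjSum (B (cen e)) with hT_def
  have hTe : ∀ e e', Sum.inl e' ∈ T e ↔ e' ∈ H.edgeSet ∧ ∃ y ∈ e', H.dist (cen e) y ≤ r := by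
    intro e e'
    simp only [hT_def, Finset.inl_mem_disjSum, hE]
  have hTv : ∀ e v, Sum.inr v ∈ T e ↔ H.dist (cen e) v ≤ 2 * r := by
    intro e v
    simp only [hT_def, Finset.inr_mem_disjSum, hB]
  have hTself : ∀ e ∈ H.edgeSet, Sum.inl e ∈ T e := fun e he =>
    (hTe e e).2 ⟨he, cen e, hcen e, by simp⟩
  have hTc : ∀ e, (T e).card ≤ N₁ + N₂ := fun e => by
    simp only [hT_def, Finset.card_disjSum]
    exact add_le_add (hEc _) (hBc _)
  set S₀ : Finset (Sym2 W ⊕ W) := F.map .inl ∪ K.biUnion T with hS₀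
  set cnt : Finset (Sym2 W) → W → ℕ := fun K' v => (K'.filter fun e => Sum.inr v ∈ T e).card
    with hcnt
  have hcntN : ∀ K' ⊆ K, ∀ v, cnt K' v ≤ N₃ := by
    intro K' hK' v
    obtain ⟨E', hE'c, hE'⟩ := hN₃ v
    refine (Finset.card_le_card fun e he => ?_).trans hE'c
    obtain ⟨heK, he⟩ := Finset.mem_filter.1 he
    refine (hE' e).2 ⟨((hK e).1 (hK' heK)).1, cen e, hcen e, ?_⟩
    rw [SimpleGraph.dist_comm]
    exact (hTv e v).1 he
  -- Interpolation: the edges of `K'` have already been lowered to `p`. Activation densities start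
  -- at `m`, not 0, since the exchange needs parameters bounded away from 0, and end below `2 * m ≤
  -- 1 - m`, as `m ≤ 1 / 3`.
  set q : Finset (Sym2 W) → Sym2 W ⊕ W → ℝ := fun K' =>
    Sum.elim (fun e => if e ∈ K' then p else p + δ) fun v => m + t * cnt K' v with hq_def
  have hqb : ∀ K' ⊆ K, ∀ i, m ≤ q K' i ∧ q K' i ≤ 1 - m := by
    intro K' hK' i
    rcases i with e | v
    · simp only [hq_def, Sum.elim_inl]
      split_ifs <;> constructor <;> linarith
    · simp only [hq_def, Sum.elim_inr]
      have h1 : (cnt K' v : ℝ) ≤ N₃ := by exact_mod_cast hcntN K' hK' v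
      have h2 : t * cnt K' v ≤ t * N₃ := mul_le_mul_of_nonneg_left h1 ht.le
      have h3 : 0 ≤ t * cnt K' v := by positivity
      constructor <;> linarith
  have hq01 : ∀ K' ⊆ K, ∀ i, 0 ≤ q K' i ∧ q K' i ≤ 1 := fun K' hK' i => by
    have := hqb K' hK' i
    constructor <;> linarith
  have key : ∀ K' ⊆ K, productExp (q ∅) S₀ ((enhancedReach H r o (n + 3 * r + 2)).indicator 1) ∅
      ≤ productExp (q K') S₀ ((enhancedReach H r o (n + 3 * r + 2)).indicator 1) ∅ := by
    intro K'
    induction K' using Finset.induction_on with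
    | empty => exact fun _ => le_rfl
    | insert e K' he ih =>
      intro hK'
      have hK'' : K' ⊆ K := (Finset.subset_insert e K').trans hK'
      have heK : e ∈ K := hK' (Finset.mem_insert_self e K')
      obtain ⟨heH, y, hy, hoy⟩ := (hK e).1 heK
      refine (ih hK'').trans ?_
      -- The larger target distance keeps every window centre far from it. Only after the exchanges
      -- is the target reduced to `n`.
      have hdist : H.dist o (cen e) + r < n + 3 * r + 2 := by
        have : H.dist o (cen e) ≤ n + 2 * r + 1 := by
          have hc := hcen e
          generalize cen e = c at hc
          induction e with | _ a b =>
          have h1 := dist_le_dist_add_one hH o (show H.Adj a b from heH)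
          have h2 := dist_le_dist_add_one hH o (show H.Adj a b from heH).symm
          rcases Sym2.mem_iff.1 hy with rfl | rfl <;> rcases Sym2.mem_iff.1 hc with rfl | rfl <;>
            omega
        omega
      have hcnt_in : ∀ v, Sum.inr v ∈ T e → cnt (insert e K') v = cnt K' v + 1 := by
        intro v hv
        simp only [hcnt]
        rw [Finset.filter_insert, if_pos hv, Finset.card_insert_of_notMem (by simp [he])]
      have hcnt_out : ∀ v, Sum.inr v ∉ T e → cnt (insert e K') v = cnt K' v := by
        intro v hv
        simp only [hcnt]
        rw [Finset.filter_insert, if_neg hv]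
      have hqe : ∀ e', e' ≠ e → q K' (Sum.inl e') = q (insert e K') (Sum.inl e') := by
        intro e' he'
        simp [hq_def, he']
      refine productExp_exchange (T := T e) (C := (T e).filter fun i => i.isRight) (e := Sum.inl e)
        (m := m) (δ := δ) (t := t)
        isUpperSet_enhancedReach ?_ (hTself e heH) (Finset.filter_subset _ _) (by simp)
        ?_ hm.le (by linarith) hδ.le ht.le ?_ (fun i _ => hq01 K' hK'' i)
        (fun i _ => hq01 _ hK' i) (fun i _ => hqb K' hK'' i) (hqb _ hK' _).1 ?_ ?_ ?_ ?_
      · exact (Finset.subset_biUnion_of_mem T heK).trans Finset.subset_union_right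
      · intro η hη B hBT h0 h1
        obtain ⟨v, hv, B', hB', h2⟩ := exists_pivotal_activation hH hdist (hTe e) (hTv e) hη
          (hTself e heH) hBT h0 h1
        exact ⟨Sum.inr v, by simp [hv], B', hB', h2⟩
      · exact mul_le_mul_of_nonneg_left
          (pow_le_pow_of_le_one hm.le (by linarith) (hTc e)) ht.le
      · simp [hq_def, he]
      · intro i hi
        obtain ⟨hiT, hi⟩ := Finset.mem_filter.1 hi
        rcases i with e' | v
        · simp at hi
        · simp only [hq_def, Sum.elim_inr, hcnt_in v hiT]
          push_cast
          linarith
      · intro i _ hie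
        rcases i with e' | v
        · exact (hqe e' fun h => hie (h ▸ rfl)).le
        · by_cases hv : Sum.inr v ∈ T e
          · simp only [hq_def, Sum.elim_inr, hcnt_in v hv]
            push_cast
            linarith
          · simp only [hq_def, Sum.elim_inr, hcnt_out v hv]
            exact le_rfl
      · intro i hi
        have hiT := (Finset.mem_sdiff.1 hi).2
        rcases i with e' | v
        · refine hqe e' fun h => hiT (h ▸ hTself e heH)
        · simp only [hq_def, Sum.elim_inr, hcnt_out v hiT]
  -- Edges outside `K` still have parameter `p + δ`, but reaching distance `n` does not depend on
  -- them, so they are dropped.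
  set K₁ : Set (Sym2 W ⊕ W) := {i | ∀ e, i = Sum.inl e → e ∈ K} with hK₁
  refine ⟨S₀.filter (· ∈ K₁), fun e he => ((hK e).1 ((Finset.mem_filter.1 he).2 e rfl)).1, ?_⟩
  have hinter : ∀ ω : Set (Sym2 W ⊕ W), (enhancedReach H r o n).indicator (1 : Set (Sym2 W ⊕ W) → ℝ) ω
      ≤ (enhancedReach H r o n).indicator (1 : Set (Sym2 W ⊕ W) → ℝ) (ω ∩ K₁) := by
    intro ω
    by_cases hω : ω ∈ enhancedReach H r o n
    · have := enhancedReach_inter hH (K := K₁) (fun e he hy e' he' => by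
        rw [← Sum.inl_injective he']; exact (hK e).2 ⟨he, hy⟩) (fun v e he => by simp at he) hω
      rw [Set.indicator_of_mem hω, Set.indicator_of_mem this]
      rfl
    · rw [Set.indicator_of_notMem hω]
      exact indicator_one_nonneg _ _
  have hmono := fun n => monotone_indicator_one (isUpperSet_enhancedReach (H := H) (r := r) (o := o)
    (n := n))
  calc _ ≤ productExp (q ∅) (F.map .inl)
          ((enhancedReach H r o (n + 3 * r + 2)).indicator 1) ∅ := by
        refine productExp_mono_left ?_ (fun i _ => hq01 ∅ (by simp) i) (hmono _) ?_
        · rintro (e | v) -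
          · simp only [Sum.elim_inl]; constructor <;> linarith
          · simp
        · rintro (e | v) hi
          · simp [hq_def]
          · simp at hi
    _ ≤ productExp (q ∅) S₀ ((enhancedReach H r o (n + 3 * r + 2)).indicator 1) ∅ :=
        productExp_mono_finset (hq01 ∅ (by simp)) (hmono _) Finset.subset_union_left
    _ ≤ productExp (q K) S₀ ((enhancedReach H r o (n + 3 * r + 2)).indicator 1) ∅ :=
        key K subset_rfl
    _ ≤ productExp (q K) S₀ ((enhancedReach H r o n).indicator 1) ∅ :=
        productExp_le (fun i _ => hq01 K subset_rfl i) fun _ _ =>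
          Set.indicator_le_indicator_of_subset (enhancedReach_anti (by omega))
            (fun _ => zero_le_one) _
    _ ≤ productExp (q K) S₀ (fun ω => (enhancedReach H r o n).indicator 1 (ω ∩ K₁)) ∅ :=
        productExp_le (fun i _ => hq01 K subset_rfl i) fun _ _ => hinter _
    _ = productExp (q K) (S₀.filter (· ∈ K₁))
          (fun ω => (enhancedReach H r o n).indicator 1 (ω ∩ K₁)) ∅ := productExp_filter K₁
    _ ≤ productExp (q K) (S₀.filter (· ∈ K₁)) ((enhancedReach H r o n).indicator 1) ∅ :=
        productExp_le (fun i _ => hq01 K subset_rfl i) fun _ _ => hmono n Set.inter_subset_left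
    _ ≤ _ := by
        refine productExp_mono_left (fun i _ => hq01 K subset_rfl i) ?_ (hmono n) ?_
        · rintro (e | v) -
          · simp only [Sum.elim_inl]; constructor <;> linarith
          · simp only [Sum.elim_inr]; constructor <;> linarith
        · rintro (e | v) hi
          · have : e ∈ K := (Finset.mem_filter.1 hi).2 e rfl
            simp [hq_def, this]
          · simp only [hq_def, Sum.elim_inr]
            have h1 : (cnt K v : ℝ) ≤ N₃ := by exact_mod_cast hcntN K subset_rfl v
            have h2 : t * cnt K v ≤ t * N₃ := mul_le_mul_of_nonneg_left h1 ht.le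
            linarith

end Comparison
end BondPercolation

/-! ### Lifts of balls and the invariant of the exploration -/

namespace BondPercolation

open Relation

section Lifting

variable {V W : Type*} {G : SimpleGraph V} {H : SimpleGraph W} {π : V → W}

/-- Steps along open edges. -/
def OpenStep (G : SimpleGraph V) (ζ : Set (Sym2 V)) (x y : V) : Prop :=
  G.Adj x y ∧ s(x, y) ∈ ζ

/-- The vertex `x` is connected to distance `n` by open edges. -/
def openReach (G : SimpleGraph V) (x : V) (n : ℕ) : Set (Set (Sym2 V)) :=
  {ζ | ∃ y, n ≤ G.dist x y ∧ ReflTransGen (OpenStep G ζ) x y}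

theorem reflTransGen_openStep_mono {ζ ζ' : Set (Sym2 V)} (h : ζ ⊆ ζ') {x y : V}
    (hs : ReflTransGen (OpenStep G ζ) x y) : ReflTransGen (OpenStep G ζ') x y :=
  ReflTransGen.mono (fun _ _ h' => ⟨h'.1, h h'.2⟩) _ _ hs

theorem isUpperSet_openReach {x : V} {n : ℕ} : IsUpperSet (openReach G x n) :=
  fun _ _ h ⟨y, hy, hs⟩ => ⟨y, hy, reflTransGen_openStep_mono h hs⟩

/-- Uniqueness of lifts at `z`, read backwards: lifting an edge from two distinct points of a fibre
gives distinct endpoints. -/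
theorem IsStrongCoveringMap.eq_of_adj (hπ : IsStrongCoveringMap G H π) {x x' z : V}
    (hx : G.Adj x z) (hx' : G.Adj x' z) (h : π x = π x') (hadj : H.Adj (π z) (π x)) : x = x' :=
  (hπ.existsUnique_lift z (π x) hadj).unique ⟨hx.symm, rfl⟩ ⟨hx'.symm, h.symm⟩

theorem IsStrongCoveringMap.surjective (hπ : IsStrongCoveringMap G H π) (hG : G.Connected)
    (hH : H.Connected) : Function.Surjective π := by
  obtain ⟨x⟩ := hG.nonempty
  intro w
  obtain ⟨p⟩ := hH.preconnected w (π x)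
  generalize hz : π x = z at p
  induction p with
  | nil => exact ⟨x, hz⟩
  | @cons a b _ hab p ih =>
    obtain ⟨y, rfl⟩ := ih hz
    obtain ⟨y', ⟨-, hy'⟩, -⟩ := hπ.existsUnique_lift y a hab.symm
    exact ⟨y', hy'⟩

/-- If all the edges above a ball, and close to a given point above its centre, are available, then
every vertex of the ball has two available lifts. -/
theorem IsStrongCoveringMap.exists_two_lifts (hπ : IsStrongCoveringMap G H π) (hG : G.Connected)
    (hH : H.Connected) {r : ℕ} {y₀ y₁ : V} (hy : π y₀ = π y₁) (hpos : 0 < G.dist y₀ y₁)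
    (hle : G.dist y₀ y₁ ≤ r) {A : Set V} (hy₀ : y₀ ∈ A)
    (hA : ∀ x y, x ∈ A → G.Adj x y → H.dist (π y₀) (π x) ≤ r → H.dist (π y₀) (π y) ≤ r →
      G.dist y₀ x ≤ 2 * r → y ∈ A) {a : W} (ha : H.dist (π y₀) a ≤ r) :
    ∃ z z', z ≠ z' ∧ z ∈ A ∧ z' ∈ A ∧ π z = a ∧ π z' = a ∧
      G.dist y₀ z ≤ 2 * r ∧ G.dist y₀ z' ≤ 2 * r := by
  -- As `π` is 1-Lipschitz, geodesics of length at most `r` from `y₀` project into the ball; in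
  -- particular `y₁ ∈ A`. Lifting a geodesic of the ball from both `y₀` and `y₁` then keeps the two
  -- lifts distinct.
  have hball : ∀ x, G.dist y₀ x ≤ r → x ∈ A := by
    intro x hx
    generalize hk : G.dist y₀ x = k at hx
    induction k generalizing x with
    | zero =>
      rw [hG.dist_eq_zero_iff] at hk
      exact hk ▸ hy₀
    | succ k ih =>
      obtain ⟨z, hzx, hz⟩ := exists_adj_dist_eq hG hk
      have h1 := hπ.dist_le y₀ z
      have h2 := hπ.dist_le y₀ x
      exact hA z x (ih z hz (by omega)) hzx (by omega) (by omega) (by omega)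
  suffices h : ∃ z z', z ≠ z' ∧ z ∈ A ∧ z' ∈ A ∧ π z = a ∧ π z' = a ∧
      G.dist y₀ z ≤ r + H.dist (π y₀) a ∧ G.dist y₀ z' ≤ r + H.dist (π y₀) a by
    obtain ⟨z, z', h1, h2, h3, h4, h5, h6, h7⟩ := h
    exact ⟨z, z', h1, h2, h3, h4, h5, by omega, by omega⟩
  generalize hk : H.dist (π y₀) a = k at ha
  induction k generalizing a with
  | zero =>
    rw [hH.dist_eq_zero_iff] at hk
    refine ⟨y₀, y₁, ?_, hy₀, hball _ hle, hk, hy ▸ hk, by simp, by omega⟩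
    rintro rfl
    simp at hpos
  | succ k ih =>
    obtain ⟨b, hba, hb⟩ := exists_adj_dist_eq hH hk
    obtain ⟨z, z', hne, hz, hz', hπz, hπz', hd, hd'⟩ := ih hb (by omega)
    obtain ⟨w, ⟨hzw, hw⟩, -⟩ := hπ.existsUnique_lift z a (hπz ▸ hba)
    obtain ⟨w', ⟨hzw', hw'⟩, -⟩ := hπ.existsUnique_lift z' a (hπz' ▸ hba)
    have h1 := dist_le_dist_add_one hG y₀ hzw
    have h2 := dist_le_dist_add_one hG y₀ hzw'
    refine ⟨w, w', ?_, hA z w hz hzw ?_ ?_ ?_, hA z' w' hz' hzw' ?_ ?_ ?_, hw, hw',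
      by omega, by omega⟩
    · rintro rfl
      exact hne (hπ.eq_of_adj hzw hzw' (hπz.trans hπz'.symm) (by rw [hw, hπz]; exact hba.symm))
    · rw [hπz]; omega
    · rw [hw]; omega
    · omega
    · rw [hπz']; omega
    · rw [hw']; omega
    · omega

open scoped Classical in
/-- The number of unexplored activations that concern the vertex `w`. -/
noncomputable def activationCount (H : SimpleGraph W) (r : ℕ) (S : Finset (Sym2 W ⊕ W)) (w : W) : ℕ :=
  (S.filter fun i => ∃ c, i = Sum.inr c ∧ H.dist c w ≤ r + 1).card

theorem activationCount_mono {r : ℕ} {S S' : Finset (Sym2 W ⊕ W)} (h : S ⊆ S') (w : W) :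
    activationCount H r S w ≤ activationCount H r S' w := by
  classical
  exact Finset.card_le_card (Finset.filter_subset_filter _ h)

theorem activationCount_pos {r : ℕ} {S : Finset (Sym2 W ⊕ W)} {c w : W} (h : Sum.inr c ∈ S)
    (hc : H.dist c w ≤ r + 1) : 1 ≤ activationCount H r S w := by
  classical
  exact Finset.card_pos.2 ⟨_, Finset.mem_filter.2 ⟨h, c, rfl, hc⟩⟩

theorem activationCount_erase [DecidableEq (Sym2 W ⊕ W)] {r : ℕ} {S : Finset (Sym2 W ⊕ W)}
    {c w : W} (h : Sum.inr c ∈ S) (hc : H.dist c w ≤ r + 1) :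
    activationCount H r (S.erase (Sum.inr c)) w + 1 = activationCount H r S w := by
  classical
  unfold activationCount
  rw [Finset.filter_erase]
  have h : Sum.inr c ∈ S.filter fun i => ∃ c, i = Sum.inr c ∧ H.dist c w ≤ r + 1 :=
    Finset.mem_filter.2 ⟨h, c, rfl, hc⟩
  convert Finset.card_erase_add_one h

theorem activationCount_le {r M : ℕ} {S : Finset (Sym2 W ⊕ W)} {w : W} {F : Finset W}
    (hF : F.card ≤ M) (hF' : ∀ y, y ∈ F ↔ H.dist w y ≤ r + 1) : activationCount H r S w ≤ M := by
  classical
  refine le_trans ?_ hF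
  rw [← Finset.card_map Function.Embedding.inr]
  refine Finset.card_le_card fun i hi => ?_
  obtain ⟨-, c, rfl, hc⟩ := Finset.mem_filter.1 hi
  exact Finset.mem_map.2 ⟨c, (hF' c).2 (by rwa [SimpleGraph.dist_comm]), rfl⟩

variable (G H π) in
/-- A stage of the simultaneous exploration of the enhanced cluster of `π x₀` and of the cluster of
`x₀`. The coordinates in `S` are unexplored in `H`, and those in `η` have been found open. The
explored cluster `T` of `H` is lifted by `l` to the cluster of `x₀` in the set `ζ` of the edges of
`G` found open. The edges of `G` keep the parameters `q`. -/
structure LiftStage (r : ℕ) (x₀ : V) (p ε : ℝ)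
    (S : Finset (Sym2 W ⊕ W)) (η : Set (Sym2 W ⊕ W)) (T : Set W) (l : W → V) (q : Sym2 V → ℝ)
    (ζ : Set (Sym2 V)) : Prop where
  notMem : ∀ i ∈ S, i ∉ η
  mem_edgeSet : ∀ e, Sum.inl e ∈ S → e ∈ H.edgeSet
  root_mem : π x₀ ∈ T
  edge_closed : ∀ u v, Sum.inl s(u, v) ∈ η → u ∈ T ∧ v ∈ T
  ball_closed : ∀ c, Sum.inr c ∈ η → ∀ v, H.dist c v ≤ r + 1 → v ∈ T
  lift : ∀ v ∈ T, π (l v) = v ∧ ReflTransGen (OpenStep G ζ) x₀ (l v)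
  param : ∀ g, 0 ≤ q g ∧ q g ≤ 1
  -- All lifts of an unexplored edge keep enough parameter for its future query.
  fresh : ∀ x y, G.Adj x y → Sum.inl s(π x, π y) ∈ S → p ≤ q s(x, y)
  -- Any other edge of `G` is open, or can afford `ε` for each activation still to come nearby, or
  -- projects to an edge not in `η` and starts from a distinguished lift. Edges whose projection is
  -- not an edge of `H` are included: they are never queried.
  used : ∀ x y, G.Adj x y → Sum.inl s(π x, π y) ∉ S →
    s(x, y) ∈ ζ ∨ ε * activationCount H r S (π x) ≤ q s(x, y) ∨
      (Sum.inl s(π x, π y) ∉ η ∧ H.Adj (π x) (π y) ∧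
        ((π x ∈ T ∧ x = l (π x)) ∨ (π y ∈ T ∧ y = l (π y))))

end Lifting
end BondPercolation

/-! ### Joint exploration of the enhanced cluster and of its lift -/

namespace BondPercolation

open Relation

section Exploration

variable {V W : Type*} {G : SimpleGraph V} {H : SimpleGraph W} {π : V → W} {r : ℕ} {x₀ : V}
  {p ε : ℝ} {S : Finset (Sym2 W ⊕ W)} {η : Set (Sym2 W ⊕ W)} {T : Set W} {l : W → V}
  {q : Sym2 V → ℝ} {ζ : Set (Sym2 V)}

/-- If no unexplored edge touches the explored cluster, then the edges of a fully open ball whose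
centre belongs to the explored cluster have all been explored, and the ball is explored. -/
theorem LiftStage.ball_explored (h : LiftStage G H π r x₀ p ε S η T l q ζ) (hH : H.Connected)
    (hS : ∀ u v, u ∈ T → Sum.inl s(u, v) ∉ S) {B : Finset (Sym2 W ⊕ W)} (hB : B ⊆ S)
    {c x : W} (hb : BallOpen H r (η ∪ ↑B) c) (hx : x ∈ T) (hcx : H.dist c x ≤ r) :
    (∀ y, H.dist c y ≤ r → y ∈ T) ∧ BallOpen H r η c := by
  have hclosed : ∀ u v, u ∈ T → H.Adj u v → H.dist c u ≤ r → H.dist c v ≤ r →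
      v ∈ T ∧ Sum.inl s(u, v) ∈ η := by
    intro u v hu huv hcu hcv
    rcases hb u v huv hcu hcv with h' | h'
    · exact ⟨(h.edge_closed u v h').2, h'⟩
    · exact absurd (hB h') (hS u v hu)
  have hc : c ∈ T := by
    generalize hk : H.dist c x = k
    induction k generalizing x with
    | zero =>
      rw [hH.dist_eq_zero_iff] at hk
      exact hk ▸ hx
    | succ k ih =>
      obtain ⟨z, hzx, hz⟩ := exists_adj_dist_eq hH hk
      exact ih (hclosed x z hx hzx.symm hcx (by omega)).1 (by omega) hz
  have hall : ∀ y, H.dist c y ≤ r → y ∈ T := by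
    intro y hy
    generalize hk : H.dist c y = k
    induction k generalizing y with
    | zero =>
      rw [hH.dist_eq_zero_iff] at hk
      exact hk ▸ hc
    | succ k ih =>
      obtain ⟨z, hzy, hz⟩ := exists_adj_dist_eq hH hk
      exact (hclosed z y (ih z (by omega) hz) hzy (by omega) hy).1
  exact ⟨hall, fun u v huv hu hv => (hclosed u v (hall u hu) huv hu hv).2⟩

/-- When no query is left, `T` contains the enhanced cluster, whatever the unexplored coordinates
are. -/
theorem LiftStage.mem_of_reflTransGen (h : LiftStage G H π r x₀ p ε S η T l q ζ)
    (hH : H.Connected) (hS : ∀ u v, u ∈ T → Sum.inl s(u, v) ∉ S)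
    (hS' : ∀ c ∈ T, Sum.inr c ∈ S → ¬ BallOpen H r η c)
    {B : Finset (Sym2 W ⊕ W)} (hB : B ⊆ S) {y : W}
    (hy : ReflTransGen (EnhancedStep H r (η ∪ ↑B)) (π x₀) y) : y ∈ T := by
  induction hy with
  | refl => exact h.root_mem
  | @tail u v _ huv ih =>
    obtain ⟨hadj, (he | he) | ⟨c, hc, hcu, hb⟩⟩ := huv
    · exact (h.edge_closed u v he).2
    · exact absurd (hB he) (hS u v ih)
    · obtain ⟨hball, hb'⟩ := h.ball_explored hH hS hB hb ih hcu
      rcases hc with hc | hc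
      · exact h.ball_closed c hc v ((dist_le_dist_add_one hH c hadj).trans (by omega))
      · exact absurd hb' (hS' c (hball c (by simp)) (hB hc))

-- The query of `s(u, v)` consumes `p` from the single lift `s(l u, y)`. If it succeeds, `y` can
-- serve as the lift of `v`; if it fails, this lift falls under the third case of `used`. The other
-- lifts of `s(u, v)` keep at least `p`, enough for all activations.
open scoped Classical in
theorem LiftStage.explore_edge (h : LiftStage G H π r x₀ p ε S η T l q ζ) (hp : 0 ≤ p)
    (hε : ∀ S w, ε * activationCount H r S w ≤ p) (hε0 : 0 ≤ ε) {u v : W} (hu : u ∈ T)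
    (huv : Sum.inl s(u, v) ∈ S) {y : V} (hy : G.Adj (l u) y) (hyv : π y = v) :
    p ≤ q s(l u, y) ∧
    LiftStage G H π r x₀ p ε (S.erase (Sum.inl s(u, v))) (insert (Sum.inl s(u, v)) η) (insert v T)
      (if v ∈ T then l else Function.update l v y)
      (Function.update q s(l u, y) (q s(l u, y) - p)) (insert s(l u, y) ζ) ∧
    LiftStage G H π r x₀ p ε (S.erase (Sum.inl s(u, v))) η T l
      (Function.update q s(l u, y) (q s(l u, y) - p)) ζ := by
  obtain ⟨hlu, hreach⟩ := h.lift u hu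
  have hpq : p ≤ q s(l u, y) := h.fresh _ _ hy (by rwa [hlu, hyv])
  have hadj : H.Adj u v := h.mem_edgeSet _ huv
  have hparam : ∀ g, 0 ≤ Function.update q s(l u, y) (q s(l u, y) - p) g ∧
      Function.update q s(l u, y) (q s(l u, y) - p) g ≤ 1 := by
    intro g
    by_cases hg : g = s(l u, y)
    · subst hg
      rw [Function.update_self]
      constructor <;> linarith [(h.param s(l u, y)).2]
    · rw [Function.update_of_ne hg]; exact h.param g
  have hfresh : ∀ a b, G.Adj a b → Sum.inl s(π a, π b) ∈ S.erase (Sum.inl s(u, v)) →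
      p ≤ Function.update q s(l u, y) (q s(l u, y) - p) s(a, b) := by
    intro a b hab hS
    have hne : s(a, b) ≠ s(l u, y) := by
      intro heq
      have : s(π a, π b) = s(u, v) := by
        rw [← Sym2.map_mk, heq, Sym2.map_mk, hlu, hyv]
      exact Finset.ne_of_mem_erase hS (by rw [this])
    rw [Function.update_of_ne hne]
    exact h.fresh a b hab (Finset.mem_of_mem_erase hS)
  have hmono : ∀ w, ε * activationCount H r (S.erase (Sum.inl s(u, v))) w
      ≤ ε * activationCount H r S w := fun w =>
    mul_le_mul_of_nonneg_left
      (by exact_mod_cast activationCount_mono (Finset.erase_subset _ _) w) hε0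
  have hused : ∀ a b, G.Adj a b → Sum.inl s(π a, π b) ∉ S.erase (Sum.inl s(u, v)) →
      s(a, b) = s(l u, y) ∨ s(a, b) ∈ ζ ∨
      ε * activationCount H r (S.erase (Sum.inl s(u, v))) (π a)
        ≤ Function.update q s(l u, y) (q s(l u, y) - p) s(a, b) ∨
      (Sum.inl s(π a, π b) ∉ insert (Sum.inl s(u, v)) η ∧ H.Adj (π a) (π b) ∧
        ((π a ∈ T ∧ a = l (π a)) ∨ (π b ∈ T ∧ b = l (π b)))) := by
    intro a b hab hS
    by_cases hne : s(a, b) = s(l u, y)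
    · exact Or.inl hne
    right
    rw [Function.update_of_ne hne]
    by_cases he : (Sum.inl s(π a, π b) : Sym2 W ⊕ W) = Sum.inl s(u, v)
    · exact Or.inr (Or.inl ((hε _ _).trans (h.fresh a b hab (he ▸ huv))))
    · rcases h.used a b hab fun h' => hS (Finset.mem_erase.2 ⟨he, h'⟩) with h1 | h1 | h1
      · exact Or.inl h1
      · exact Or.inr (Or.inl ((hmono _).trans h1))
      · exact Or.inr (Or.inr ⟨fun h' => h'.elim he h1.1, h1.2⟩)
  have hl : ∀ w ∈ T, (if v ∈ T then l else Function.update l v y) w = l w := by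
    intro w hw
    split_ifs with hv
    · rfl
    · exact Function.update_of_ne (fun h' : w = v => hv (h' ▸ hw)) _ _
  refine ⟨hpq, ⟨?_, ?_, Or.inr h.root_mem, ?_, ?_, ?_, hparam, hfresh, ?_⟩,
    ⟨?_, ?_, h.root_mem, h.edge_closed, h.ball_closed, h.lift, hparam, hfresh, ?_⟩⟩
  · rintro i hi (rfl | hi')
    · simp at hi
    · exact h.notMem i (Finset.mem_of_mem_erase hi) hi'
  · exact fun e he => h.mem_edgeSet e (Finset.mem_of_mem_erase he)
  · rintro a b (hab | hab)
    · rcases Sym2.eq_iff.1 (Sum.inl_injective hab) with ⟨rfl, rfl⟩ | ⟨rfl, rfl⟩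
      · exact ⟨Or.inr hu, Or.inl rfl⟩
      · exact ⟨Or.inl rfl, Or.inr hu⟩
    · exact ⟨Or.inr (h.edge_closed a b hab).1, Or.inr (h.edge_closed a b hab).2⟩
  · rintro c (hc | hc) w hw
    · cases hc
    · exact Or.inr (h.ball_closed c hc w hw)
  · intro w hw
    by_cases hwT : w ∈ T
    · rw [hl w hwT]
      exact ⟨(h.lift w hwT).1, reflTransGen_openStep_mono (Set.subset_insert _ _) (h.lift w hwT).2⟩
    · obtain rfl : w = v := hw.resolve_right hwT
      rw [if_neg hwT, Function.update_self]
      exact ⟨hyv, (reflTransGen_openStep_mono (Set.subset_insert _ _) hreach).tail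
        ⟨hy, Set.mem_insert _ _⟩⟩
  · intro a b hab hS
    rcases hused a b hab hS with h1 | h1 | h1 | ⟨h1, h2, h3⟩
    · exact Or.inl (Or.inl h1)
    · exact Or.inl (Or.inr h1)
    · exact Or.inr (Or.inl h1)
    · refine Or.inr (Or.inr ⟨h1, h2, h3.imp ?_ ?_⟩)
      · rintro ⟨h4, h5⟩; exact ⟨Or.inr h4, by rwa [hl _ h4]⟩
      · rintro ⟨h4, h5⟩; exact ⟨Or.inr h4, by rwa [hl _ h4]⟩
  · exact fun i hi => h.notMem i (Finset.mem_of_mem_erase hi)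
  · exact fun e he => h.mem_edgeSet e (Finset.mem_of_mem_erase he)
  · intro a b hab hS
    rcases hused a b hab hS with h1 | h1 | h1 | ⟨h1, h2, h3⟩
    · refine Or.inr (Or.inr ?_)
      have hab' : s(π a, π b) = s(u, v) := by
        rw [← Sym2.map_mk, h1, Sym2.map_mk, hlu, hyv]
      refine ⟨hab' ▸ h.notMem _ huv, ?_, ?_⟩
      · rw [← SimpleGraph.mem_edgeSet, hab']; exact hadj
      · rcases Sym2.eq_iff.1 h1 with ⟨rfl, rfl⟩ | ⟨rfl, rfl⟩
        · exact Or.inl (by rw [hlu]; exact ⟨hu, rfl⟩)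
        · exact Or.inr (by rw [hlu]; exact ⟨hu, rfl⟩)
    · exact Or.inl h1
    · exact Or.inr (Or.inl h1)
    · exact Or.inr (Or.inr ⟨fun h' => h1 (Or.inr h'), h2, h3⟩)

-- The edges of `Q` pay `ε` each. If all their extra trials succeed, the ball and its outer
-- neighbours acquire lifts in the cluster of `x₀`; if not, the payment is covered because one
-- nearby activation fewer remains.
open scoped Classical in
theorem LiftStage.explore_activation (h : LiftStage G H π r x₀ p ε S η T l q ζ)
    (hπ : IsStrongCoveringMap G H π) (hG : G.Connected) (hH : H.Connected)
    (htame : ∀ x, ∃ y, π x = π y ∧ 0 < G.dist x y ∧ G.dist x y ≤ r) (hε0 : 0 ≤ ε)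
    (hS : ∀ u v, u ∈ T → Sum.inl s(u, v) ∉ S) {c : W} (hc : c ∈ T) (hcS : Sum.inr c ∈ S)
    (hb : BallOpen H r η c) {K : Finset (Sym2 V)}
    (hK : ∀ g, g ∈ K ↔ g ∈ G.edgeSet ∧ ∃ y ∈ g, G.dist (l c) y ≤ 2 * r) :
    ∃ Q ⊆ K, (∀ g ∈ Q, ε ≤ q g) ∧ ∃ l',
    LiftStage G H π r x₀ p ε (S.erase (Sum.inr c)) (insert (Sum.inr c) η)
      (T ∪ {v | H.dist c v ≤ r + 1}) l' (fun g => if g ∈ Q then q g - ε else q g) (ζ ∪ ↑Q) ∧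
    LiftStage G H π r x₀ p ε (S.erase (Sum.inr c)) η T l
      (fun g => if g ∈ Q then q g - ε else q g) ζ := by
  obtain ⟨hlc, hreach⟩ := h.lift c hc
  have hb' : BallOpen H r (η ∪ ↑(∅ : Finset (Sym2 W ⊕ W))) c := by simpa using hb
  have hball := (h.ball_explored hH hS (Finset.empty_subset S) hb' hc (by simp)).1
  -- Excluding lifts of unexplored edges preserves `fresh`. Asking that both ends project within `r
  -- + 1` of `c` makes the activation count drop at either end.
  set Q := K.filter fun g => ε ≤ q g ∧ Sum.inl (g.map π) ∉ S ∧ ∀ z ∈ g, H.dist c (π z) ≤ r + 1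
    with hQ
  have hQK : Q ⊆ K := Finset.filter_subset _ _
  refine ⟨Q, hQK, fun g hg => (Finset.mem_filter.1 hg).2.1, ?_⟩
  -- the available edges above the ball
  have hstep : ∀ x y, G.Adj x y → H.dist c (π x) ≤ r → H.dist c (π y) ≤ r + 1 →
      G.dist (l c) x ≤ 2 * r → s(x, y) ∈ ζ ∪ ↑Q ∨ (Sum.inl s(π x, π y) ∉ η ∧ H.Adj (π x) (π y) ∧
      ((π x ∈ T ∧ x = l (π x)) ∨ (π y ∈ T ∧ y = l (π y)))) := by
    intro x y hxy hx hy hd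
    have hSxy : Sum.inl s(π x, π y) ∉ S := hS _ _ (hball _ hx)
    rcases h.used x y hxy hSxy with h1 | h1 | h1
    · exact Or.inl (Or.inl h1)
    · refine Or.inl (Or.inr (Finset.mem_filter.2 ⟨(hK _).2 ⟨hxy, x, Sym2.mem_mk_left x y, hd⟩,
        ?_, by rwa [Sym2.map_mk], ?_⟩))
      · refine le_trans ?_ h1
        have : (1 : ℝ) ≤ activationCount H r S (π x) := by
          exact_mod_cast activationCount_pos hcS (by omega)
        nlinarith
      · intro z hz
        rcases Sym2.mem_iff.1 hz with rfl | rfl <;> omega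
    · exact Or.inr h1
  -- Such a `v` lies just outside the ball. Inside it, the third case of `used` is impossible since
  -- all edges are in `η`, so a neighbour `a` of `v` in the ball has two reachable lifts.
  have hlift : ∀ v, v ∉ T → H.dist c v ≤ r + 1 →
      ∃ y, π y = v ∧ ReflTransGen (OpenStep G (ζ ∪ ↑Q)) x₀ y := by
    intro v hv hcv
    have hcv' : H.dist c v = r + 1 := by
      by_contra hne
      exact hv (hball v (by omega))
    obtain ⟨a, hav, ha⟩ := exists_adj_dist_eq hH hcv'
    obtain ⟨y₁, hy₁, hpos, hle⟩ := htame (l c)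
    obtain ⟨z, z', hne, hz, hz', hπz, hπz', hd, hd'⟩ := hπ.exists_two_lifts hG hH hy₁ hpos hle
      (A := {x | ReflTransGen (OpenStep G (ζ ∪ ↑Q)) x₀ x})
      (reflTransGen_openStep_mono Set.subset_union_left hreach)
      (by
        intro x y hx hxy hcx hcy hd
        rw [hlc] at hcx hcy
        rcases hstep x y hxy hcx (by omega) hd with h1 | ⟨h1, h2, -⟩
        · exact ReflTransGen.tail hx ⟨hxy, h1⟩
        · exact absurd (hb _ _ h2 hcx hcy) h1) (a := a) (by rw [hlc]; omega)
    have hfinal : ∀ z, π z = a → ReflTransGen (OpenStep G (ζ ∪ ↑Q)) x₀ z →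
        G.dist (l c) z ≤ 2 * r → z ≠ l a →
        ∃ y, π y = v ∧ ReflTransGen (OpenStep G (ζ ∪ ↑Q)) x₀ y := by
      intro z hπz hz hd hza
      obtain ⟨y, ⟨hzy, hy⟩, -⟩ := hπ.existsUnique_lift z v (hπz ▸ hav)
      refine ⟨y, hy, hz.tail ⟨hzy, ?_⟩⟩
      refine (hstep z y hzy (by rw [hπz]; omega) (by rw [hy]; omega) hd).resolve_right ?_
      rintro ⟨-, -, ⟨-, h1⟩ | ⟨h1, -⟩⟩
      · exact hza (hπz ▸ h1)
      · exact hv (hy ▸ h1)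
    -- Only the edge issued from `l a` may have been found closed, as `v` is not yet in `T`; the
    -- exit uses a lift of `a` other than `l a`.
    by_cases hza : z = l a
    · exact hfinal z' hπz' hz' hd' fun h' => hne (hza.trans h'.symm)
    · exact hfinal z hπz hz hd hza
  have hlift' : ∃ l' : W → V, (∀ v ∈ T, l' v = l v) ∧ ∀ v, v ∈ T ∪ {v | H.dist c v ≤ r + 1} →
      π (l' v) = v ∧ ReflTransGen (OpenStep G (ζ ∪ ↑Q)) x₀ (l' v) := by
    have : ∀ v, ∃ y, (v ∈ T → y = l v) ∧ (v ∈ T ∪ {v | H.dist c v ≤ r + 1} →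
        π y = v ∧ ReflTransGen (OpenStep G (ζ ∪ ↑Q)) x₀ y) := by
      intro v
      by_cases hv : v ∈ T
      · exact ⟨l v, fun _ => rfl, fun _ => ⟨(h.lift v hv).1,
          reflTransGen_openStep_mono Set.subset_union_left (h.lift v hv).2⟩⟩
      · by_cases hcv : H.dist c v ≤ r + 1
        · obtain ⟨y, hy⟩ := hlift v hv hcv
          exact ⟨y, fun h' => absurd h' hv, fun _ => hy⟩
        · exact ⟨l v, fun _ => rfl, fun h' => (h'.elim hv hcv).elim⟩
    choose l' hl' using this
    exact ⟨l', fun v => (hl' v).1, fun v => (hl' v).2⟩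
  obtain ⟨l', hl', hlift'⟩ := hlift'
  have hparam : ∀ g, 0 ≤ (if g ∈ Q then q g - ε else q g) ∧
      (if g ∈ Q then q g - ε else q g) ≤ 1 := by
    intro g
    split_ifs with hg
    · have := (Finset.mem_filter.1 hg).2.1
      constructor <;> linarith [(h.param g).2]
    · exact h.param g
  have hfresh : ∀ a b, G.Adj a b → Sum.inl s(π a, π b) ∈ S.erase (Sum.inr c) →
      p ≤ if s(a, b) ∈ Q then q s(a, b) - ε else q s(a, b) := by
    intro a b hab hSab
    have hSab := Finset.mem_of_mem_erase hSab
    rw [if_neg]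
    · exact h.fresh a b hab hSab
    · intro hg
      exact (Finset.mem_filter.1 hg).2.2.1 (by rwa [Sym2.map_mk])
  have hused : ∀ a b, G.Adj a b → Sum.inl s(π a, π b) ∉ S.erase (Sum.inr c) → s(a, b) ∈ ζ ∨
      ε * activationCount H r (S.erase (Sum.inr c)) (π a)
        ≤ (if s(a, b) ∈ Q then q s(a, b) - ε else q s(a, b)) ∨
      (Sum.inl s(π a, π b) ∉ η ∧ H.Adj (π a) (π b) ∧
        ((π a ∈ T ∧ a = l (π a)) ∨ (π b ∈ T ∧ b = l (π b)))) := by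
    intro a b hab hSab
    rcases h.used a b hab fun h' => hSab (Finset.mem_erase.2 ⟨by simp, h'⟩) with h1 | h1 | h1
    · exact Or.inl h1
    · refine Or.inr (Or.inl ?_)
      split_ifs with hg
      · have := activationCount_erase hcS
          ((Finset.mem_filter.1 hg).2.2.2 a (Sym2.mem_mk_left a b))
        rw [← this] at h1
        push_cast at h1
        linarith
      · refine le_trans (mul_le_mul_of_nonneg_left ?_ hε0) h1
        exact_mod_cast activationCount_mono (Finset.erase_subset _ _) _
    · exact Or.inr (Or.inr h1)
  refine ⟨l', ⟨?_, ?_, Or.inl h.root_mem, ?_, ?_, hlift', hparam, hfresh, ?_⟩,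
    ⟨?_, ?_, h.root_mem, h.edge_closed, h.ball_closed, h.lift, hparam, hfresh, hused⟩⟩
  · rintro i hi (rfl | hi')
    · simp at hi
    · exact h.notMem i (Finset.mem_of_mem_erase hi) hi'
  · exact fun e he => h.mem_edgeSet e (Finset.mem_of_mem_erase he)
  · rintro a b (hab | hab)
    · cases hab
    · exact ⟨Or.inl (h.edge_closed a b hab).1, Or.inl (h.edge_closed a b hab).2⟩
  · rintro d (hd | hd) w hw
    · obtain rfl := Sum.inr_injective hd
      exact Or.inr hw
    · exact Or.inl (h.ball_closed d hd w hw)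
  · intro a b hab hSab
    rcases hused a b hab hSab with h1 | h1 | ⟨h1, h2, h3⟩
    · exact Or.inl (Or.inl h1)
    · exact Or.inr (Or.inl h1)
    · refine Or.inr (Or.inr ⟨fun h' => h'.elim (fun h' => by cases h') h1, h2, h3.imp ?_ ?_⟩)
      · rintro ⟨h4, h5⟩; exact ⟨Or.inl h4, by rwa [hl' _ h4]⟩
      · rintro ⟨h4, h5⟩; exact ⟨Or.inl h4, by rwa [hl' _ h4]⟩
  · exact fun i hi => h.notMem i (Finset.mem_of_mem_erase hi)
  · exact fun e he => h.mem_edgeSet e (Finset.mem_of_mem_erase he)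

open scoped Classical in
/-- At every stage of the exploration, the cluster in `G` is at least as likely to be large as the
enhanced cluster in `H`. -/
theorem LiftStage.productExp_le (hπ : IsStrongCoveringMap G H π) (hG : G.Connected)
    (hH : H.Connected) (htame : ∀ x, ∃ y, π x = π y ∧ 0 < G.dist x y ∧ G.dist x y ≤ r)
    (hp : 0 ≤ p) (hp1 : p ≤ 1) (hε : ∀ S w, ε * activationCount H r S w ≤ p) (hε0 : 0 ≤ ε)
    (hε1 : ε ≤ 1) {N : ℕ} (hN : ∀ x, ∃ K : Finset (Sym2 V), K.card ≤ N ∧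
      ∀ g, g ∈ K ↔ g ∈ G.edgeSet ∧ ∃ y ∈ g, G.dist x y ≤ 2 * r)
    {s : ℝ} (hs : 0 ≤ s) (hsε : s ≤ ε ^ N) (n : ℕ)
    (h : LiftStage G H π r x₀ p ε S η T l q ζ) :
    ∃ F : Finset (Sym2 V), ↑F ⊆ G.edgeSet ∧
      productExp (Sum.elim (fun _ => p) fun _ => s) S
        ((enhancedReach H r (π x₀) n).indicator 1) η
        ≤ productExp q F ((openReach G x₀ n).indicator 1) ζ := by
  have hs1 : s ≤ 1 := hsε.trans (pow_le_one₀ hε0 hε1)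
  have hq : ∀ i : Sym2 W ⊕ W, 0 ≤ (Sum.elim (fun _ => p) fun _ => s : Sym2 W ⊕ W → ℝ) i ∧
      (Sum.elim (fun _ => p) fun _ => s : Sym2 W ⊕ W → ℝ) i ≤ 1 := by
    rintro (e | v)
    · exact ⟨hp, hp1⟩
    · exact ⟨hs, hs1⟩
  have hmono : Monotone ((openReach G x₀ n).indicator (1 : Set (Sym2 V) → ℝ)) :=
    monotone_indicator_one isUpperSet_openReach
  induction S using Finset.strongInduction generalizing η T l q ζ with
  | H S ih =>
  -- Stop when the target is reached: `π` being 1-Lipschitz, the lift is at least as far from `x₀`.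
  by_cases hfar : ∃ v ∈ T, n ≤ H.dist (π x₀) v
  · obtain ⟨v, hv, hnv⟩ := hfar
    obtain ⟨hlv, hreach⟩ := h.lift v hv
    refine ⟨∅, by simp, ?_⟩
    rw [productExp_empty, Set.indicator_of_mem]
    · exact productExp_le_one (fun i _ => hq i) (indicator_one_le_one _)
    · exact ⟨l v, hnv.trans (by simpa only [hlv] using hπ.dist_le x₀ (l v)), hreach⟩
  by_cases hedge : ∃ u v, u ∈ T ∧ Sum.inl s(u, v) ∈ S
  · obtain ⟨u, v, hu, huv⟩ := hedge
    have hadj : H.Adj u v := h.mem_edgeSet _ huv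
    obtain ⟨y, ⟨hy, hyv⟩, -⟩ := hπ.existsUnique_lift (l u) v ((h.lift u hu).1.symm ▸ hadj)
    obtain ⟨hpq, h1, h0⟩ := h.explore_edge hp hε hε0 hu huv hy hyv
    obtain ⟨F₁, hF₁, hle₁⟩ := ih _ (Finset.erase_ssubset huv) h1
    obtain ⟨F₀, hF₀, hle₀⟩ := ih _ (Finset.erase_ssubset huv) h0
    set g := s(l u, y)
    refine ⟨insert g (F₁ ∪ F₀), ?_, ?_⟩
    · intro e he
      simp only [Finset.coe_insert, Finset.coe_union] at he
      rcases he with rfl | he | he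
      · exact hy
      · exact hF₁ he
      · exact hF₀ he
    · rw [productExp_eq_erase huv]
      refine le_trans ?_ (productExp_sprinkle (fun i _ => h.param i) hmono
        (Finset.mem_insert_self g _) hp hpq)
      simp only [Sum.elim_inl]
      refine add_le_add (mul_le_mul_of_nonneg_left (hle₁.trans ?_) hp)
        (mul_le_mul_of_nonneg_left (hle₀.trans ?_) (by linarith))
      · exact productExp_mono_finset h0.param hmono
          (Finset.subset_union_left.trans (Finset.subset_insert _ _))
      · exact productExp_mono_finset h0.param hmono
          (Finset.subset_union_right.trans (Finset.subset_insert _ _))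
  have hS : ∀ u v, u ∈ T → Sum.inl s(u, v) ∉ S := fun u v hu huv => hedge ⟨u, v, hu, huv⟩
  by_cases hact : ∃ c ∈ T, Sum.inr c ∈ S ∧ BallOpen H r η c
  · obtain ⟨c, hc, hcS, hb⟩ := hact
    obtain ⟨K, hKN, hK⟩ := hN (l c)
    obtain ⟨Q, hQK, hQε, l', h1, h0⟩ :=
      h.explore_activation hπ hG hH htame hε0 hS hc hcS hb hK
    obtain ⟨F₁, hF₁, hle₁⟩ := ih _ (Finset.erase_ssubset hcS) h1
    obtain ⟨F₀, hF₀, hle₀⟩ := ih _ (Finset.erase_ssubset hcS) h0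
    refine ⟨Q ∪ (F₁ ∪ F₀), ?_, ?_⟩
    · intro e he
      simp only [Finset.coe_union] at he
      rcases he with he | he | he
      · exact ((hK e).1 (hQK he)).1
      · exact hF₁ he
      · exact hF₀ he
    · rw [productExp_eq_erase hcS]
      refine le_trans ?_ (productExp_sprinkle_finset h.param hmono (S := Q ∪ (F₁ ∪ F₀))
        Finset.subset_union_left hε0 hε1 hQε)
      simp only [Sum.elim_inr]
      have hsQ : s ≤ ε ^ Q.card :=
        hsε.trans (pow_le_pow_of_le_one hε0 hε1 ((Finset.card_le_card hQK).trans hKN))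
      have h2 := hle₁.trans (productExp_mono_finset h0.param hmono
        (Finset.subset_union_left.trans Finset.subset_union_right : F₁ ⊆ Q ∪ (F₁ ∪ F₀)))
      have h3 := hle₀.trans (productExp_mono_finset h0.param hmono
        (Finset.subset_union_right.trans Finset.subset_union_right : F₀ ⊆ Q ∪ (F₁ ∪ F₀)))
      have h4 := productExp_mono_set (S := Q ∪ (F₁ ∪ F₀)) (fun i _ => h0.param i) hmono
        (Set.subset_union_left : ζ ⊆ ζ ∪ ↑Q)
      -- The success probability `ε ^ Q.card` in `G` is at least `s`, and success can only help.
      nlinarith [mul_le_mul_of_nonneg_left h2 hs,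
        mul_le_mul_of_nonneg_left h3 (sub_nonneg.2 hs1),
        mul_nonneg (sub_nonneg.2 hsQ) (sub_nonneg.2 h4)]
  · refine ⟨∅, by simp, ?_⟩
    rw [productExp_empty]
    refine le_trans ?_ (indicator_one_nonneg (openReach G x₀ n) ζ)
    rw [← productExp_const (q := Sum.elim (fun _ => p) fun _ => s) (S := S) (η := η) 0]
    refine BondPercolation.productExp_le (fun i _ => hq i) fun B hB => ?_
    rw [Set.indicator_of_notMem]
    rintro ⟨y, hy, hreach⟩
    refine hfar ⟨y, h.mem_of_reflTransGen hH hS ?_ hB hreach, hy⟩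
    exact fun c hc hcS hb => hact ⟨c, hc, hcS, hb⟩

end Exploration
end BondPercolation

/-! ### From the percolation measure to finite expectations; positivity of the critical parameter -/

namespace BondPercolation

open Relation MeasureTheory ProbabilityTheory unitInterval

section Percolation

variable {V : Type*} {G : SimpleGraph V}

/-- The set of the open edges of a configuration. -/
def openEdges (G : SimpleGraph V) (ω : Config G) : Set (Sym2 V) :=
  {e | ∃ h : e ∈ G.edgeSet, ω ⟨e, h⟩ = true}

theorem mem_cluster_iff {ω : Config G} {x y : V} :
    y ∈ cluster G ω x ↔ ReflTransGen (OpenStep G (openEdges G ω)) x y := by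
  have h : (openGraph G ω).Adj = OpenStep G (openEdges G ω) := by
    ext a b
    exact ⟨fun ⟨h, hω⟩ => ⟨h, h, hω⟩, fun ⟨_, h, hω⟩ => ⟨h, hω⟩⟩
  rw [← h]
  exact SimpleGraph.reachable_iff_reflTransGen x y

instance (p : I) : IsProbabilityMeasure (percolation G p) := by
  unfold percolation; infer_instance

open scoped Classical in
theorem measurableSet_and_percolation_openEdges_inter_eq (p : I) {F : Finset (Sym2 V)}
    (hF : ↑F ⊆ G.edgeSet) {B : Finset (Sym2 V)} (hB : B ⊆ F) :
    MeasurableSet {ω | openEdges G ω ∩ ↑F = ↑B} ∧ percolation G p {ω | openEdges G ω ∩ ↑F = ↑B}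
      = ENNReal.ofReal ((∏ _i ∈ B, (p : ℝ)) * ∏ _i ∈ F \ B, (1 - (p : ℝ))) := by
  have hset : {ω : Config G | openEdges G ω ∩ ↑F = ↑B}
      = Set.pi ↑(F.subtype (· ∈ G.edgeSet)) fun i => {decide (i.1 ∈ B)} := by
    ext ω
    simp only [Set.mem_ofPred_eq, Set.mem_pi, Finset.mem_coe, Finset.mem_subtype,
      Set.mem_singleton_iff]
    constructor
    · rintro h ⟨e, he⟩ heF
      have : e ∈ openEdges G ω ∩ ↑F ↔ e ∈ (↑B : Set (Sym2 V)) := by rw [h]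
      simp only [openEdges, Set.mem_inter_iff, Set.mem_ofPred_eq, Finset.mem_coe] at this
      rw [Bool.eq_iff_iff, decide_eq_true_iff, ← this]
      exact ⟨fun h => ⟨⟨he, h⟩, heF⟩, fun ⟨⟨_, h⟩, _⟩ => h⟩
    · intro h
      ext e
      simp only [openEdges, Set.mem_inter_iff, Set.mem_ofPred_eq, Finset.mem_coe]
      constructor
      · rintro ⟨⟨he, hω⟩, heF⟩
        rw [h ⟨e, he⟩ heF] at hω
        exact of_decide_eq_true hω
      · intro heB
        refine ⟨⟨hF (hB heB), ?_⟩, hB heB⟩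
        rw [h ⟨e, _⟩ (hB heB)]
        exact decide_eq_true heB
  have hm : ∀ i ∈ F.subtype (· ∈ G.edgeSet), MeasurableSet ({decide (i.1 ∈ B)} : Set Bool) :=
    fun _ _ => MeasurableSet.singleton _
  rw [hset]
  refine ⟨MeasurableSet.pi (Finset.countable_toSet _) fun i hi => hm i hi, ?_⟩
  rw [percolation, Measure.infinitePi_pi _ hm]
  have hval : ∀ i : G.edgeSet, bernoulliMeasure true false p {decide (i.1 ∈ B)}
      = ENNReal.ofReal (if i.1 ∈ B then (p : ℝ) else 1 - p) := by
    intro i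
    rw [bernoulliMeasure_apply p (MeasurableSet.singleton _)]
    by_cases h : i.1 ∈ B <;> simp [h, ENNReal.ofReal, toNNReal, Real.toNNReal_of_nonneg, p.2.1,
      p.2.2] <;> rfl
  rw [Finset.prod_congr rfl fun i _ => hval i, ← ENNReal.ofReal_prod_of_nonneg]
  · congr 1
    rw [Finset.prod_subtype_of_mem (fun e => if e ∈ B then (p : ℝ) else 1 - p) fun e he => hF he,
      Finset.prod_ite, Finset.filter_mem_eq_inter, Finset.inter_eq_right.2 hB,
      Finset.filter_notMem_eq_sdiff]
  · intro i _
    split_ifs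
    · exact p.2.1
    · exact sub_nonneg.2 p.2.2

open scoped Classical in
theorem measurableSet_and_percolation_openEdges_inter_mem (p : I) {F : Finset (Sym2 V)}
    (hF : ↑F ⊆ G.edgeSet) (A : Set (Set (Sym2 V))) :
    MeasurableSet {ω | openEdges G ω ∩ ↑F ∈ A} ∧ percolation G p {ω | openEdges G ω ∩ ↑F ∈ A}
      = ENNReal.ofReal (productExp (fun _ => (p : ℝ)) F (A.indicator 1) ∅) := by
  have hset : {ω : Config G | openEdges G ω ∩ ↑F ∈ A}
      = ⋃ B ∈ F.powerset.filter fun B => ↑B ∈ A, {ω | openEdges G ω ∩ ↑F = ↑B} := by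
    ext ω
    simp only [Set.mem_ofPred_eq, Set.mem_iUnion, Finset.mem_filter, Finset.mem_powerset,
      exists_prop]
    constructor
    · intro h
      have hB : ↑(F.filter (· ∈ openEdges G ω)) = openEdges G ω ∩ ↑F := by
        ext e; simp [and_comm]
      exact ⟨F.filter (· ∈ openEdges G ω), ⟨Finset.filter_subset _ _, hB ▸ h⟩, hB.symm⟩
    · rintro ⟨B, ⟨-, hB⟩, h⟩
      rwa [h]
  have hmeas := fun (B : Finset (Sym2 V)) (hB : B ∈ F.powerset.filter fun B => ↑B ∈ A) =>
    measurableSet_and_percolation_openEdges_inter_eq p hF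
      (Finset.mem_powerset.1 (Finset.mem_filter.1 hB).1)
  rw [hset]
  refine ⟨Finset.measurableSet_biUnion _ fun B hB => (hmeas B hB).1, ?_⟩
  rw [measure_biUnion_finset _ fun B hB => (hmeas B hB).1,
    Finset.sum_congr rfl fun B hB => (hmeas B hB).2, ← ENNReal.ofReal_sum_of_nonneg]
  · congr 1
    rw [productExp, Finset.sum_filter]
    refine Finset.sum_congr rfl fun B _ => ?_
    rw [Set.empty_union]
    split_ifs with h
    · rw [Set.indicator_of_mem h]; simp
    · rw [Set.indicator_of_notMem h]; simp
  · intro B _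
    exact mul_nonneg (Finset.prod_nonneg fun _ _ => p.2.1)
      (Finset.prod_nonneg fun _ _ => sub_nonneg.2 p.2.2)
  · intro B _ B' _ hne
    refine Set.disjoint_left.2 fun ω h h' => hne ?_
    exact Finset.coe_injective (Eq.trans (Eq.symm h) h')

theorem exists_openReach_iff_inter (hG : G.Connected) (hd : BoundedDegree G) (x : V) (n : ℕ) :
    ∃ F : Finset (Sym2 V), ↑F ⊆ G.edgeSet ∧
      ∀ ζ, ζ ∈ openReach G x n ↔ ζ ∩ ↑F ∈ openReach G x n := by
  obtain ⟨_, hF⟩ := hd.exists_edgeBall hG n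
  obtain ⟨F, -, hF⟩ := hF x
  refine ⟨F, fun e he => ((hF e).1 he).1, fun ζ => ⟨?_, fun h =>
    isUpperSet_openReach Set.inter_subset_left h⟩⟩
  rintro ⟨y, hy, hxy⟩
  have : ζ ∩ ↑F ∈ openReach G x n ∨ ReflTransGen (OpenStep G (ζ ∩ ↑F)) x y := by
    clear hy
    induction hxy with
    | refl => exact Or.inr .refl
    | @tail a b _ hab ih =>
      rcases ih with ih | ih
      · exact Or.inl ih
      by_cases ha : n ≤ G.dist x a
      · exact Or.inl ⟨a, ha, ih⟩
      · exact Or.inr (ih.tail ⟨hab.1, hab.2, (hF _).2 ⟨hab.1, a, Sym2.mem_mk_left a b, by omega⟩⟩)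
  exact this.elim id fun h => ⟨y, hy, h⟩

theorem infinite_cluster_iff (hG : G.Connected) (hd : BoundedDegree G) {ω : Config G} {x : V} :
    (cluster G ω x).Infinite ↔ ∀ n, openEdges G ω ∈ openReach G x n := by
  constructor
  · intro h n
    by_contra hn
    obtain ⟨_, hF⟩ := hd.exists_ball hG n
    obtain ⟨F, -, hF⟩ := hF x
    refine h (F.finite_toSet.subset fun y hy => (hF y).2 ?_)
    by_contra! hlt
    exact hn ⟨y, hlt.le, mem_cluster_iff.1 hy⟩
  · intro h hfin
    obtain ⟨N, hN⟩ := (hfin.image (G.dist x)).bddAbove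
    obtain ⟨y, hy, hxy⟩ := h (N + 1)
    have := hN ⟨y, mem_cluster_iff.2 hxy, rfl⟩
    omega

open scoped Classical in
theorem exists_percolation_openReach (hG : G.Connected) (hd : BoundedDegree G) (x : V) (n : ℕ) :
    ∃ F : Finset (Sym2 V), ↑F ⊆ G.edgeSet ∧ ∀ p : I,
      MeasurableSet {ω | openEdges G ω ∈ openReach G x n} ∧
      percolation G p {ω | openEdges G ω ∈ openReach G x n}
        = ENNReal.ofReal (productExp (fun _ => (p : ℝ)) F ((openReach G x n).indicator 1) ∅) := by
  obtain ⟨F, hF, h⟩ := exists_openReach_iff_inter hG hd x n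
  refine ⟨F, hF, fun p => ?_⟩
  have hset : {ω | openEdges G ω ∈ openReach G x n}
      = {ω | openEdges G ω ∩ ↑F ∈ openReach G x n} := Set.ext fun ω => h _
  rw [hset]
  exact measurableSet_and_percolation_openEdges_inter_mem p hF _

-- The events of reaching distance `n` decrease to the event that the cluster of `x` is infinite, so
-- a uniform lower bound survives in the limit. Allowing any `q ≥ p` builds in monotonicity in the
-- parameter.
open scoped Classical in
theorem not_ae_not_hasInfiniteCluster (hG : G.Connected) (hd : BoundedDegree G) {p : ℝ}
    (hp : 0 ≤ p) {q : I} (hpq : p ≤ q) {x : V} {c : ℝ} (hc : 0 < c)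
    (h : ∀ n, ∃ F : Finset (Sym2 V), ↑F ⊆ G.edgeSet ∧
      c ≤ productExp (fun _ => p) F ((openReach G x n).indicator 1) ∅) :
    ¬ ∀ᵐ ω ∂(percolation G q), ¬ HasInfiniteCluster G ω := by
  intro hae
  have hmeas : ∀ n, MeasurableSet {ω : Config G | openEdges G ω ∈ openReach G x n} := fun n => by
    obtain ⟨F, -, h⟩ := exists_percolation_openReach hG hd x n
    exact (h q).1
  have hanti : Antitone fun n => {ω : Config G | openEdges G ω ∈ openReach G x n} :=
    fun m n hmn ω ⟨y, hy, hxy⟩ => ⟨y, hmn.trans hy, hxy⟩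
  have hle : ∀ n, ENNReal.ofReal c
      ≤ percolation G q {ω | openEdges G ω ∈ openReach G x n} := by
    intro n
    obtain ⟨F, hF, hcF⟩ := h n
    have h1 := (measurableSet_and_percolation_openEdges_inter_mem q hF (openReach G x n)).2
    refine le_trans ?_ (measure_mono (s := {ω | openEdges G ω ∩ ↑F ∈ openReach G x n})
      fun ω hω => isUpperSet_openReach Set.inter_subset_left hω)
    rw [h1]
    refine ENNReal.ofReal_le_ofReal (hcF.trans ?_)
    exact productExp_mono_left (fun _ _ => ⟨hp, hpq.trans q.2.2⟩) (fun _ _ => q.2)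
      (monotone_indicator_one isUpperSet_openReach) fun _ _ => hpq
  have hlim := tendsto_measure_iInter_atTop (μ := percolation G q)
    (fun n => (hmeas n).nullMeasurableSet) hanti ⟨0, measure_ne_top _ _⟩
  have hpos := ge_of_tendsto' hlim hle
  have hzero : percolation G q (⋂ n, {ω | openEdges G ω ∈ openReach G x n}) = 0 := by
    refine measure_mono_null (fun ω hω => ?_) (ae_iff.1 hae)
    simp only [Set.mem_iInter, Set.mem_ofPred_eq] at hω
    exact fun hn => hn ⟨x, (infinite_cluster_iff hG hd).2 hω⟩
  rw [hzero, nonpos_iff_eq_zero, ENNReal.ofReal_eq_zero] at hpos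
  linarith

-- There are countably many vertices, so one of them has an infinite cluster with positive
-- probability; this probability is the uniform bound.
open scoped Classical in
theorem exists_le_productExp_openReach (hG : G.Connected) (hd : BoundedDegree G) {q : I}
    (h : ¬ ∀ᵐ ω ∂(percolation G q), ¬ HasInfiniteCluster G ω) :
    ∃ x, ∃ c > 0, ∀ n, ∃ F : Finset (Sym2 V), ↑F ⊆ G.edgeSet ∧
      c ≤ productExp (fun _ => (q : ℝ)) F ((openReach G x n).indicator 1) ∅ := by
  have := hd.countable hG
  obtain ⟨x, hx⟩ : ∃ x, percolation G q {ω | (cluster G ω x).Infinite} ≠ 0 := by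
    by_contra! hx
    refine h (ae_iff.2 (measure_mono_null (fun ω hω => ?_) (measure_iUnion_null hx)))
    simp only [Set.mem_ofPred_eq, not_not] at hω
    exact Set.mem_iUnion.2 hω
  refine ⟨x, (percolation G q {ω | (cluster G ω x).Infinite}).toReal,
    ENNReal.toReal_pos hx (measure_ne_top _ _), fun n => ?_⟩
  obtain ⟨F, hF, hFq⟩ := exists_percolation_openReach hG hd x n
  refine ⟨F, hF, ?_⟩
  have h1 : percolation G q {ω | (cluster G ω x).Infinite}
      ≤ percolation G q {ω | openEdges G ω ∈ openReach G x n} :=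
    measure_mono fun ω hω => (infinite_cluster_iff hG hd).1 hω n
  rw [(hFq q).2] at h1
  refine ENNReal.toReal_le_of_le_ofReal ?_ h1
  exact productExp_nonneg (fun _ _ => q.2) (indicator_one_nonneg _)

/-- Cut the path after its last visit to `v`: the rest avoids all edges at `v`, hence is independent
of the edge `s(v, w)`. -/
theorem exists_first_edge {ζ : Set (Sym2 V)} {v : V} {n : ℕ} (hG : G.Connected)
    (h : ζ ∈ openReach G v (n + 1)) :
    ∃ w, G.Adj v w ∧ s(v, w) ∈ ζ ∧ ζ \ {s(v, w)} ∈ openReach G w n := by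
  obtain ⟨y, hy, hvy⟩ := h
  have hne : v ≠ y := by rintro rfl; simp at hy
  set ζ' := ζ \ {e | v ∈ e} with hζ'
  have key : ∀ z, ReflTransGen (OpenStep G ζ) z y → ReflTransGen (OpenStep G ζ') z y ∨
      ∃ w, G.Adj v w ∧ s(v, w) ∈ ζ ∧ ReflTransGen (OpenStep G ζ') w y := by
    intro z hz
    induction hz using ReflTransGen.head_induction_on with
    | refl => exact Or.inl .refl
    | @head a b hab _ ih =>
      rcases ih with ih | ih
      · by_cases hav : v = a
        · subst hav
          exact Or.inr ⟨b, hab.1, hab.2, ih⟩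
        by_cases hbv : v = b
        · subst hbv
          rcases ih.cases_head with h | ⟨w, hw, -⟩
          · exact absurd h hne
          · exact absurd (Sym2.mem_mk_left v w) hw.2.2
        · refine Or.inl (ih.head ⟨hab.1, hab.2, fun h => ?_⟩)
          rcases Sym2.mem_iff.1 h with h | h
          · exact hav h
          · exact hbv h
      · exact Or.inr ih
  rcases key v hvy with h | ⟨w, hvw, hw, h⟩
  · rcases h.cases_head with h | ⟨w, hw, -⟩
    · exact absurd h hne
    · exact absurd (Sym2.mem_mk_left v w) hw.2.2
  · refine ⟨w, hvw, hw, y, ?_, reflTransGen_openStep_mono ?_ h⟩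
    · have := dist_le_dist_add_one hG y hvw.symm
      rw [SimpleGraph.dist_comm, SimpleGraph.dist_comm (v := w)] at this
      omega
    · exact Set.sdiff_subset_sdiff_right fun e he => by
        rw [Set.mem_singleton_iff.1 he]
        exact Sym2.mem_mk_left v w

theorem productExp_sum {ι κ : Type*} [DecidableEq ι] {q : ι → ℝ} {S : Finset ι} {η : Set ι}
    (K : Finset κ) (f : κ → Set ι → ℝ) :
    productExp q S (fun ω => ∑ k ∈ K, f k ω) η = ∑ k ∈ K, productExp q S (f k) η := by
  simp only [productExp, Finset.mul_sum]
  exact Finset.sum_comm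

-- Union bound over the first edge, of probability `p`, and induction on the remaining edges.
open scoped Classical in
theorem productExp_openReach_le_pow (hG : G.Connected) {D : ℕ} {nb : V → Finset V}
    (hnb : ∀ v w, G.Adj v w → w ∈ nb v) (hD : ∀ v, (nb v).card ≤ D) {p : ℝ} (hp : 0 ≤ p)
    (hp1 : p ≤ 1) (n : ℕ) (F : Finset (Sym2 V)) (v : V) :
    productExp (fun _ => p) F ((openReach G v n).indicator 1) ∅ ≤ (D * p) ^ n := by
  have hq : ∀ F : Finset (Sym2 V), ∀ i ∈ F, 0 ≤ (fun _ => p : Sym2 V → ℝ) i ∧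
      (fun _ => p : Sym2 V → ℝ) i ≤ 1 := fun _ _ _ => ⟨hp, hp1⟩
  induction n generalizing F v with
  | zero =>
    rw [pow_zero]
    exact productExp_le_one (hq F) (indicator_one_le_one _)
  | succ n ih =>
    set A : V → Set (Set (Sym2 V)) := fun w =>
      {ω | s(v, w) ∈ ω ∧ ω \ {s(v, w)} ∈ openReach G w n} with hA
    have h1 : productExp (fun _ => p) F ((openReach G v (n + 1)).indicator 1) ∅
        ≤ ∑ w ∈ nb v, productExp (fun _ => p) F ((A w).indicator 1) ∅ := by
      rw [← productExp_sum]
      refine productExp_le (hq F) fun B _ => ?_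
      by_cases hB : ∅ ∪ (↑B : Set (Sym2 V)) ∈ openReach G v (n + 1)
      · rw [Set.indicator_of_mem hB]
        obtain ⟨w, hvw, hw, hr⟩ := exists_first_edge hG hB
        refine le_trans ?_ (Finset.single_le_sum (fun w _ => indicator_one_nonneg (A w) _)
          (hnb v w hvw))
        rw [Set.indicator_of_mem (show _ ∈ A w from ⟨hw, hr⟩)]
      · rw [Set.indicator_of_notMem hB]
        exact Finset.sum_nonneg fun w _ => indicator_one_nonneg _ _
    have hzero : ∀ w, ∀ F : Finset (Sym2 V), s(v, w) ∉ F →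
        productExp (fun _ => p) F ((A w).indicator 1) ∅ = 0 := by
      intro w F hF
      rw [← productExp_const (q := fun _ => p) (S := F) (η := ∅) 0]
      refine productExp_congr fun B hB => Set.indicator_of_notMem ?_ _
      rintro ⟨h | h, -⟩
      · exact h
      · exact hF (hB h)
    have h2 : ∀ w, productExp (fun _ => p) F ((A w).indicator 1) ∅ ≤ p * (D * p) ^ n := by
      intro w
      by_cases hF : s(v, w) ∈ F
      · rw [productExp_eq_erase hF, hzero w _ (Finset.notMem_erase _ _), mul_zero, add_zero]
        refine mul_le_mul_of_nonneg_left (le_trans ?_ (ih (F.erase s(v, w)) w)) hp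
        refine productExp_le (hq _) fun B hB => ?_
        by_cases hA' : insert s(v, w) ∅ ∪ (↑B : Set (Sym2 V)) ∈ A w
        · have : ∅ ∪ (↑B : Set (Sym2 V)) ∈ openReach G w n := by
            refine isUpperSet_openReach (fun e he => ?_) hA'.2
            obtain ⟨(he | he) | he, he'⟩ := he
            · exact absurd he he'
            · exact Or.inl he
            · exact Or.inr he
          rw [Set.indicator_of_mem this]
          exact indicator_one_le_one _ _
        · rw [Set.indicator_of_notMem hA']
          exact indicator_one_nonneg _ _
      · rw [hzero w F hF]
        positivity
    calc _ ≤ _ := h1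
      _ ≤ ∑ _w ∈ nb v, p * (D * p) ^ n := Finset.sum_le_sum fun w _ => h2 w
      _ = (nb v).card * (p * (D * p) ^ n) := by rw [Finset.sum_const, nsmul_eq_mul]
      _ ≤ D * (p * (D * p) ^ n) :=
          mul_le_mul_of_nonneg_right (by exact_mod_cast hD v) (by positivity)
      _ = _ := by ring

theorem bddAbove_criticalParameter_set :
    BddAbove {p : ℝ | ∃ hp : p ∈ I, ∀ᵐ ω ∂(percolation G ⟨p, hp⟩), ¬ HasInfiniteCluster G ω} :=
  ⟨1, fun _ ⟨hp, _⟩ => hp.2⟩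

theorem criticalParameter_pos (hG : G.Connected) (hd : BoundedDegree G) :
    0 < criticalParameter G := by
  classical
  obtain ⟨D, hD⟩ := id hd
  have hfin : ∀ x, (G.neighborSet x).Finite := fun x => Set.finite_of_encard_le_coe (hD x)
  have hcard : ∀ x, (hfin x).toFinset.card ≤ D := fun x => by
    have := hD x
    rw [(hfin x).encard_eq_coe_toFinset_card] at this
    exact_mod_cast this
  -- At this parameter `D * p < 1`, so the probability of reaching distance `n` tends to 0.
  have hp0 : (0 : ℝ) < 1 / (D + 1) := by positivity
  have hp1 : (1 : ℝ) / (D + 1) ≤ 1 := by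
    rw [div_le_one (by positivity)]
    linarith [D.cast_nonneg (α := ℝ)]
  refine hp0.trans_le (le_csSup bddAbove_criticalParameter_set ⟨⟨hp0.le, hp1⟩, ?_⟩)
  by_contra hae
  obtain ⟨x, c, hc, h⟩ := exists_le_productExp_openReach hG hd hae
  have hlt : (D : ℝ) * (1 / (D + 1)) < 1 := by
    rw [mul_one_div, div_lt_one (by positivity)]
    linarith
  obtain ⟨n, hn⟩ := exists_pow_lt_of_lt_one hc hlt
  obtain ⟨F, -, hF⟩ := h n
  have := productExp_openReach_le_pow hG (nb := fun v => (hfin v).toFinset)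
    (fun v w hvw => by simpa using hvw) hcard hp0.le hp1 n F x
  exact absurd (hF.trans this) (not_le.2 hn)

end Percolation

end BondPercolation

/-! ### Conclusion -/

namespace BondPercolation

open Relation unitInterval

section Main

variable {V W : Type*} {G : SimpleGraph V} {H : SimpleGraph W} {π : V → W}

theorem image_inl_mem_enhancedReach {r n : ℕ} {o : W} {ω : Set (Sym2 W)} :
    Sum.inl '' ω ∈ enhancedReach H r o n ↔ ω ∈ openReach H o n := by
  have h : EnhancedStep H r (Sum.inl '' ω) = OpenStep H ω := by
    ext x y
    simp [EnhancedStep, OpenStep]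
  simp only [enhancedReach, openReach, Set.mem_ofPred_eq, h]

open scoped Classical in
theorem productExp_openReach_eq (r n : ℕ) (o : W) (p s : ℝ) (F : Finset (Sym2 W)) :
    productExp (fun _ => p) F ((openReach H o n).indicator 1) ∅
      = productExp (Sum.elim (fun _ => p) fun _ => s) (F.map .inl)
          ((enhancedReach H r o n).indicator 1) ∅ := by
  have h := productExp_map (q := Sum.elim (fun _ => p) fun _ => s)
    (f := (enhancedReach H r o n).indicator 1) (Function.Embedding.inl : Sym2 W ↪ Sym2 W ⊕ W) F ∅
  rw [Set.image_empty] at h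
  rw [h]
  refine productExp_congr fun B _ => ?_
  rw [show ⇑(Function.Embedding.inl : Sym2 W ↪ Sym2 W ⊕ W) = Sum.inl from rfl]
  simp only [Set.indicator, image_inl_mem_enhancedReach, Pi.one_apply]

open scoped Classical in
/-- The cluster in `G` is stochastically at least as large as the enhanced cluster in `H`. -/
theorem exists_productExp_enhancedReach_le (hG : G.Connected) (hH : H.Connected)
    (hGd : BoundedDegree G) (hHd : BoundedDegree H) (hπ : IsStrongCoveringMap G H π) {r : ℕ}
    (htame : ∀ x, ∃ y, π x = π y ∧ 0 < G.dist x y ∧ G.dist x y ≤ r) {a : ℝ} (ha : 0 < a)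
    (ha1 : a ≤ 1) :
    ∃ s₀ > 0, ∀ s, 0 ≤ s → s ≤ s₀ → ∀ p, a ≤ p → p ≤ 1 → ∀ (x : V) (n : ℕ)
      (S : Finset (Sym2 W ⊕ W)), (∀ e, Sum.inl e ∈ S → e ∈ H.edgeSet) →
      ∃ F : Finset (Sym2 V), ↑F ⊆ G.edgeSet ∧
        productExp (Sum.elim (fun _ => p) fun _ => s) S
          ((enhancedReach H r (π x) n).indicator 1) ∅
          ≤ productExp (fun _ => p) F ((openReach G x n).indicator 1) ∅ := by
  obtain ⟨N, hN⟩ := hGd.exists_edgeBall hG (2 * r)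
  obtain ⟨M, hM⟩ := hHd.exists_ball hH (r + 1)
  -- At most `M` activations concern a given vertex, so parameter `a ≤ p` pays `ε` for each.
  set ε : ℝ := a / (M + 1) with hε_def
  have hε : 0 < ε := by positivity
  have hεM : ε * (M + 1) = a := div_mul_cancel₀ _ (by positivity)
  have hεa : ε ≤ a := div_le_self ha.le (by linarith [M.cast_nonneg (α := ℝ)])
  refine ⟨ε ^ N, by positivity, fun s hs hsε p hap hp1 x n S hS => ?_⟩
  have hcount : ∀ (S : Finset (Sym2 W ⊕ W)) w, ε * activationCount H r S w ≤ p := by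
    intro S w
    obtain ⟨F, hF, hF'⟩ := hM w
    have h1 : (activationCount H r S w : ℝ) ≤ M := by exact_mod_cast activationCount_le hF hF'
    nlinarith
  have hstage : LiftStage G H π r x p ε S ∅ {π x} (fun _ => x) (fun _ => p) ∅ := by
    refine ⟨fun _ _ => id, hS, rfl, fun _ _ h => h.elim, fun _ h => h.elim, ?_,
      fun _ => ⟨by linarith, hp1⟩, fun _ _ _ _ => le_rfl, fun y _ _ _ =>
        Or.inr (Or.inl (hcount _ _))⟩
    rintro v rfl
    exact ⟨rfl, .refl⟩
  exact hstage.productExp_le hπ hG hH htame (by linarith) hp1 hcount hε.le (by linarith) hN hs hsε n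

theorem criticalParameter_lt (hG : G.Connected) (hH : H.Connected)
    (hGd : BoundedDegree G) (hHd : BoundedDegree H) (hπ : IsStrongCoveringMap G H π)
    (htame : HasTameFibres G π) (hpc : criticalParameter G < 1) :
    criticalParameter G < criticalParameter H := by
  classical
  by_cases hH1 : 1 ≤ criticalParameter H
  · exact hpc.trans_le hH1
  rw [not_le] at hH1
  have hH0 := criticalParameter_pos hH hHd
  set pc := criticalParameter H with hpc_def
  obtain ⟨r, htame⟩ := htame
  set a : ℝ := min (pc / 2) ((1 - pc) / 2) with ha_def
  have ha : 0 < a := lt_min (by linarith) (by linarith)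
  have ha1 : a ≤ pc / 2 := min_le_left _ _
  have ha2 : a ≤ (1 - pc) / 2 := min_le_right _ _
  obtain ⟨s₀, hs₀, hlift⟩ := exists_productExp_enhancedReach_le hG hH hGd hHd hπ htame ha
    (by linarith)
  -- The bound `2 * m ≤ s₀` makes the activation density produced by the enhancement admissible for
  -- the lifting.
  set m : ℝ := min a (s₀ / 2) with hm_def
  have hm : 0 < m := lt_min ha (by linarith)
  have hma : m ≤ a := min_le_left _ _
  have hms : m ≤ s₀ / 2 := min_le_right _ _
  obtain ⟨δ, hδ, hδm, hgain⟩ := exists_enhancement_gain hH hHd r hm (by linarith)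
  -- Thus `p < pc < p + δ`; the choice of `a` and `δ ≤ m ≤ a` give `a ≤ p` and `p + δ ≤ 1 - m`.
  set p : ℝ := pc - δ / 2 with hp_def
  have hqI : p + δ ∈ I := ⟨by linarith, by linarith⟩
  have hq : ¬ ∀ᵐ ω ∂(percolation H ⟨p + δ, hqI⟩), ¬ HasInfiniteCluster H ω := by
    intro h
    have := le_csSup bddAbove_criticalParameter_set ⟨hqI, h⟩
    change p + δ ≤ pc at this
    linarith
  obtain ⟨o, c, hc, hperc⟩ := exists_le_productExp_openReach hH hHd hq
  obtain ⟨x, rfl⟩ := hπ.surjective hG hH o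
  have hGperc : ∀ n, ∃ F : Finset (Sym2 V), ↑F ⊆ G.edgeSet ∧
      c ≤ productExp (fun _ => p) F ((openReach G x n).indicator 1) ∅ := by
    intro n
    obtain ⟨F, hF, hcF⟩ := hperc (n + 3 * r + 2)
    obtain ⟨S, hS, hle⟩ := hgain p (by linarith) (by linarith) (π x) n F hF
    obtain ⟨F', hF', hle'⟩ := hlift (2 * m) (by linarith) (by linarith) p (by linarith)
      (by linarith) x n S hS
    refine ⟨F', hF', hcF.trans (le_trans ?_ (hle.trans hle'))⟩
    rw [← productExp_openReach_eq]
  refine lt_of_le_of_lt (Real.sSup_le (fun q ⟨hqI, hq⟩ => ?_) (by linarith : (0 : ℝ) ≤ p))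
    (by linarith : p < pc)
  by_contra! hpq
  exact not_ae_not_hasInfiniteCluster hG hGd (by linarith : (0 : ℝ) ≤ p) (q := ⟨q, hqI⟩) hpq.le hc
    hGperc hq

end Main

end BondPercolation

theorem corollary2p3 {V W : Type*} (G : SimpleGraph V) (H : SimpleGraph W)
    (hG : G.Connected) (hH : H.Connected)
    (hGdeg : BondPercolation.BoundedDegree G) (hHdeg : BondPercolation.BoundedDegree H)
    (π : V → W) (hπ : BondPercolation.IsStrongCoveringMap G H π)
    (htame : BondPercolation.HasTameFibres G π)
    (hpc : BondPercolation.criticalParameter G < 1) :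
    BondPercolation.criticalParameter G < BondPercolation.criticalParameter H := by
  exact BondPercolation.criticalParameter_lt hG hH hGdeg hHdeg hπ htame hpc
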